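/- Let $n\ge 1$ and $b\ge 2$ be integers. Let $M=(M(i,j))_{0\le i,j\le n-1}$ be the transition matrix of Holte's carries Markov chain for adding $n$ random numbers in base $b$, i.e. $M(i,j)$ is the probability that $\lfloor (i+X_1+\cdots+X_n)/b\rfloor=j$, where $X_1,\dots,X_n$ are independent and uniformly distributed on $\{0,1,\dots,b-1\}$ (the chance that the next carry is $j$ given that the last carry is $i$). For $\pi\in S_n$ let $\ell(\pi)$ be the number of cycles of $\pi$, fixed points included, and let $C_k=\{\pi\in S_n\mid \ell(\pi)=k\}$. Let $\mathrm{CF}_\ell(S_n)$ be the space of all functions $\vartheta:S_n\to\mathbb C$ such that $\vartheta(\sigma)=\vartheta(\tau)$ whenever $\ell(\sigma)=\ell(\tau)$, and write $\vartheta(C_k)$ for the value of such a $\vartheta$ on $C_k$. For $\vartheta,\psi\in\mathrm{CF}_\ell(S_n)$ put \[[\vartheta,\psi]=\frac{1}{n!}\sum_{k,l=1}^{n}\vartheta(C_k)\,\overline{\psi(C_l)}\;\mathbf E\,|\sigma C_k\cap\tau C_l|,\] where $\sigma$ and $\tau$ are $n$-cycles chosen independently and uniformly at random from $C_1$. For $0\le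 i\le n-1$ let $\phi_i$ be the Foulkes character of $S_n$, i.e. the complex character afforded by the direct sum of the Specht modules $V_\beta$, one for each border shape $\beta$ (connected skew shape containing no $2\times 2$ square, up to translation) with $n$ boxes and $i+1$ rows. Then each $\phi_i$ belongs to $\mathrm{CF}_\ell(S_n)$, and \[M(i,j)=[\phi_i,\;b^{\ell-n}\phi_j]\qquad(0\le i,j\le n-1),\] where $b^{\ell-n}\phi_j$ denotes the function $\pi\mapsto b^{\ell(\pi)-n}\phi_j(\pi)$. -/

import Mathlib

noncomputable section

namespace FoulkesCarries

/-! ### Carries -/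

/-- A column of digits `d 0, …, d (n - 1)` in base `b` is added, together with the carry `i` from
the previous column.  The new carry is `⌊(i + d 0 + ⋯ + d (n - 1)) / b⌋`; it is again one of
`0, …, n - 1`. -/
def nextCarry (n b : ℕ) (i : Fin n) (d : Fin n → Fin b) : Fin n :=
  ⟨((i : ℕ) + ∑ k, (d k : ℕ)) / b, by
    have hb : 0 < b := (Nat.zero_le _).trans_lt (d i).isLt
    have hs : ∑ k, (d k : ℕ) ≤ ∑ _k : Fin n, (b - 1) :=
      Finset.sum_le_sum fun k _ => Nat.le_sub_one_of_lt (d k).isLt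
    rw [Finset.sum_const, Finset.card_univ, Fintype.card_fin, smul_eq_mul] at hs
    have hn : n * (b - 1) + n = n * b := by
      conv_rhs => rw [← Nat.sub_add_cancel hb]
      ring
    have hi := i.isLt
    exact (Nat.div_lt_iff_lt_mul hb).2 (by omega)⟩

/-- The transition matrix of the carries chain for adding `n` random numbers in base `b`:
the entry `(i, j)` is the chance that the next carry is `j`, given that the last carry is `i`,
when the `n` digits of the next column are independent and uniform in `{0, …, b - 1}`
(so that all `b ^ n` columns of digits are equally likely). -/
def carriesMatrix (n b : ℕ) : Matrix (Fin n) (Fin n) ℝ := fun i j =>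
  ((Finset.univ.filter fun d : Fin n → Fin b => nextCarry n b i d = j).card : ℝ) /
    (Fintype.card (Fin n → Fin b) : ℝ)

/-! ### Specht modules of border shapes -/

/-- `ℂ[S_n]`. -/
abbrev SymAlg (n : ℕ) : Type := MonoidAlgebra ℂ (Equiv.Perm (Fin n))

/-- Let `T` be the tableau with entry `m` in the box `(row m, col m)`.  The sum in `ℂ[S_n]` of the
elements of the row group of `T`, i.e. of the permutations that preserve each row of `T`. -/
def rowSum {n : ℕ} (row : Fin n → ℤ) : SymAlg n := by
  classical
  exact ∑ p ∈ Finset.univ.filter (fun p : Equiv.Perm (Fin n) => ∀ m, row (p m) = row m),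
    MonoidAlgebra.of ℂ (Equiv.Perm (Fin n)) p

/-- The signed sum in `ℂ[S_n]` of the elements of the column group of `T`. -/
def colSignedSum {n : ℕ} (col : Fin n → ℤ) : SymAlg n := by
  classical
  exact ∑ q ∈ Finset.univ.filter (fun q : Equiv.Perm (Fin n) => ∀ m, col (q m) = col m),
    ((Equiv.Perm.sign q : ℤ) : ℂ) • MonoidAlgebra.of ℂ (Equiv.Perm (Fin n)) q

/-- The Specht module of the shape with boxes `(row m, col m)`, `m : Fin n`: it is the submodule of
the permutation module on row tabloids (which is the left ideal generated by `rowSum row`) spanned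
by the polytabloids, i.e. the left ideal of `ℂ[S_n]` generated by `colSignedSum col * rowSum row`. -/
def spechtModule {n : ℕ} (row col : Fin n → ℤ) : Submodule (SymAlg n) (SymAlg n) :=
  Submodule.span (SymAlg n) {colSignedSum col * rowSum row}

/-- The character of `S_n` afforded by the Specht module. -/
def spechtCharacter {n : ℕ} (row col : Fin n → ℤ) : Equiv.Perm (Fin n) → ℂ :=
  (Representation.ofModule' (k := ℂ) (G := Equiv.Perm (Fin n))
    (spechtModule row col)).character

/-- Border shapes (connected skew shapes without a `2 × 2` square) with `n` boxes correspond to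
compositions of `n`, the sequences of their row lengths from bottom to top.  Number the boxes
`0, …, n - 1` along the shape, from the lower left to the upper right end.  The row of the box `m`,
counted from below, is the block of the composition that contains `m`. -/
def borderRow {n : ℕ} (c : Composition n) (m : Fin n) : ℤ := ((c.index m : ℕ) : ℤ)

/-- The column of the box `m` in the border shape: each step along the shape goes either one box to
the right or one box up, so that (row) + (column) increases by one. -/
def borderCol {n : ℕ} (c : Composition n) (m : Fin n) : ℤ := ((m : ℕ) : ℤ) - borderRow c m

/-- The Foulkes character `φ_i` of `S_n`: the character afforded by the sum of the Specht modules of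
all border shapes with `n` boxes and `i + 1` rows. -/
def foulkes (n i : ℕ) : Equiv.Perm (Fin n) → ℂ := fun π =>
  ∑ c ∈ Finset.univ.filter (fun c : Composition n => c.length = i + 1),
    spechtCharacter (borderRow c) (borderCol c) π

/-! ### Class functions that depend only on the number of cycles -/

/-- The number of cycles of `π`, fixed points included. -/
def numCycles {n : ℕ} (π : Equiv.Perm (Fin n)) : ℕ := Multiset.card π.partition.parts

/-- `C_k`, the set of permutations in `S_n` with `k` cycles. -/
def cycleClass (n k : ℕ) : Finset (Equiv.Perm (Fin n)) :=
  Finset.univ.filter fun π => numCycles π = k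

/-- The space `CF_ℓ(S_n)` of functions on `S_n` that depend only on the number of cycles. -/
def CFlen (n : ℕ) : Submodule ℂ (Equiv.Perm (Fin n) → ℂ) where
  carrier := {θ | ∀ σ τ, numCycles σ = numCycles τ → θ σ = θ τ}
  add_mem' := fun ha hb σ τ h => by simp only [Pi.add_apply, ha σ τ h, hb σ τ h]
  zero_mem' := fun _ _ _ => rfl
  smul_mem' := fun _ _ ha σ τ h => by simp only [Pi.smul_apply, ha σ τ h]

open Classical in
/-- `θ(C_k)`, the value of `θ ∈ CF_ℓ(S_n)` at any element of `C_k`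
(which is non-empty for `1 ≤ k ≤ n`). -/
def classValue {n : ℕ} (θ : CFlen n) (k : ℕ) : ℂ :=
  if h : (cycleClass n k).Nonempty then θ.1 h.choose else 0

/-- The expected value of `|σ C_k ∩ τ C_l|` for `σ` and `τ` chosen independently and uniformly at
random from the set `C_1` of `n`-cycles. -/
def expectedCommon (n k l : ℕ) : ℝ :=
  (∑ σ ∈ cycleClass n 1, ∑ τ ∈ cycleClass n 1,
      ((((cycleClass n k).image fun x => σ * x) ∩
        ((cycleClass n l).image fun y => τ * y)).card : ℝ)) /
    ((cycleClass n 1).card : ℝ) ^ 2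

/-- `[θ, ψ] = (1 / |S_n|) ∑_{k, l = 1}^n θ(C_k) conj(ψ(C_l)) E|σ C_k ∩ τ C_l|`. -/
def bracket {n : ℕ} (θ ψ : CFlen n) : ℂ :=
  (1 / (Fintype.card (Equiv.Perm (Fin n)) : ℂ)) *
    ∑ k ∈ Finset.Icc 1 n, ∑ l ∈ Finset.Icc 1 n,
      classValue θ k * (starRingEnd ℂ) (classValue ψ l) * (expectedCommon n k l : ℂ)

/-- Multiplication of elements of `CF_ℓ(S_n)` by the function `b^{ℓ - n}`. -/
def twist {n : ℕ} (b : ℕ) (ψ : CFlen n) : CFlen n :=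
  ⟨fun π => (b : ℂ) ^ ((numCycles π : ℤ) - (n : ℤ)) * ψ.1 π, fun σ τ h => by
    simp only [h, ψ.2 σ τ h]⟩

end FoulkesCarries

end

noncomputable section
namespace FoulkesCarries

open Equiv Equiv.Perm

/-! ### The number of cycles of a permutation -/

section Cycles

variable {n : ℕ}

/-! Everything is expanded in the functions `x ^ ℓ`, for natural numbers `x`. Two facts about them
carry the proof.

Foulkes characters. `x ^ ℓ(π)` counts the words fixed by `π` (`card_invariant_colorings`). Sorting
words by their increasing rearrangement turns this into a sum of permutation characters on row
tabloids of border shapes. Encode a border shape by the set `D` of boxes after which it goes up. The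
tabloid module of `D` is the direct sum of the Specht modules of all `E ⊆ D`
(`borderTabloid_eq_iSup`, `iSupIndep_borderSpecht`). Counting words gives `x ^ ℓ = ∑ r, φ_r * (x + n
- 1 - r).choose n` (`pow_numCycles_eq_sum_foulkes`). This triangular system inverts to `φ_i = ∑ k,
(-1) ^ k * (n + 1).choose k * (i + 1 - k) ^ ℓ` (`foulkes_eq_foulkesValue`), so `φ_i` depends only on
`ℓ`.

The pairing. Since `σ` and `τ` are independent, the bracket is, up to a constant, the ordinary inner
product of convolutions with the sum `Z` of all `n`-cycles (`bracket_eq`). With `P_x = ∑ g, x ^ ℓ(g)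
g`, the quantity needed is the coefficient of `1` in `Z² P_x P_y`. Central elements act on the Young
symmetrizer of the hook with leg `r` by scalars: `Z` by `(-1) ^ r r! (n - 1 - r)!`, and `P_x` by `n!
* (x + n - 1 - r).choose n`, a product over the contents of the hook. Only hooks see `n`-cycles, so
an alternating sum over hooks recovers the coefficient of `1` in `Z u` for central `u`
(`alternating_sum_hookScalar`). Hence the pairing of `x ^ ℓ` and `y ^ ℓ` is diagonal in the
binomials above (`sum_longTranslate_pow`).

Together: expanding `φ_i` in powers and inverting leaves only the term `r = i`, while `b ^ (ℓ - n)
φ_j` contributes the powers of `b * (j + 1 - k)`. What remains is Holte's alternating formula for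
the carries matrix (`carriesMatrix_eq`). -/

lemma numCycles_eq (p : Perm (Fin n)) :
    numCycles p = p.cycleFactorsFinset.card + (n - p.support.card) := by
  simp [numCycles, parts_partition, cycleType_def]

lemma sum_partition_parts (p : Perm (Fin n)) : p.partition.parts.sum = n :=
  p.partition.parts_sum.trans (Fintype.card_fin n)

lemma numCycles_le (p : Perm (Fin n)) : numCycles p ≤ n := by
  have h := sum_partition_parts p
  have h1 : Multiset.card p.partition.parts • 1 ≤ p.partition.parts.sum :=
    Multiset.card_nsmul_le_sum fun x hx => p.partition.parts_pos hx
  simpa [numCycles, h] using h1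

lemma numCycles_pos (hn : 0 < n) (p : Perm (Fin n)) : 0 < numCycles p := by
  have h := sum_partition_parts p
  rw [numCycles, Multiset.card_pos]
  intro h0
  rw [h0] at h
  simp at h
  omega

lemma numCycles_eq_of_isConj {p q : Perm (Fin n)} (h : IsConj p q) :
    numCycles p = numCycles q := by
  rw [numCycles, numCycles, partition_eq_of_isConj.1 h]

lemma numCycles_mul_comm (p q : Perm (Fin n)) : numCycles (p * q) = numCycles (q * p) :=
  numCycles_eq_of_isConj (isConj_iff.2 ⟨q, by group⟩)

lemma numCycles_inv (p : Perm (Fin n)) : numCycles p⁻¹ = numCycles p :=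
  numCycles_eq_of_isConj (isConj_of_cycleType_eq (cycleType_inv p))

lemma numCycles_one : numCycles (1 : Perm (Fin n)) = n := by
  simp [numCycles_eq]

lemma isConj_of_numCycles_eq_one {p q : Perm (Fin n)} (hp : numCycles p = 1)
    (hq : numCycles q = 1) : IsConj p q := by
  have key : ∀ r : Perm (Fin n), numCycles r = 1 → r.partition.parts = {n} := by
    intro r hr
    obtain ⟨a, ha⟩ := Multiset.card_eq_one.1 hr
    have h := sum_partition_parts r
    rw [ha, Multiset.sum_singleton] at h
    rw [ha, h]
  rw [partition_eq_of_isConj]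
  ext1
  rw [key p hp, key q hq]

lemma apply_eq_of_sameCycle {α β : Type*} [Finite α] {p : Perm α} {f : α → β}
    (hf : ∀ a, f (p a) = f a) {x y : α} (h : p.SameCycle x y) : f x = f y := by
  obtain ⟨i, -, -, rfl⟩ := h.exists_pow_eq''
  clear h
  induction i with
  | zero => rfl
  | succ k ih => rw [pow_succ', Perm.mul_apply, hf, ih]

/-- A permutation has `x ^ ℓ` invariant colourings with `x` colours. -/
lemma card_invariant_colorings (x : ℕ) (p : Perm (Fin n)) :
    (Finset.univ.filter fun f : Fin n → Fin x => ∀ a, f (p a) = f a).card =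
      x ^ numCycles p := by
  classical
  -- A label for the cycle of `a`. Fixed points need their own summand because `cycleOf` is `1` at
  -- each of them.
  let φ : Fin n → Perm (Fin n) ⊕ Fin n := fun a =>
    if p a = a then Sum.inr a else Sum.inl (p.cycleOf a)
  have hφ : ∀ a b, φ a = φ b ↔ p.SameCycle a b := by
    intro a b
    by_cases ha : p a = a <;> by_cases hb : p b = b
    · simp only [φ, ha, hb, if_true, Sum.inr.injEq]
      exact ⟨fun h => h ▸ SameCycle.refl _ _, fun h => (h.eq_of_left ha)⟩
    · simp only [φ, ha, hb, if_true, if_false, reduceCtorEq, false_iff]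
      exact fun h => hb ((h.apply_eq_self_iff).1 ha)
    · simp only [φ, ha, hb, if_true, if_false, reduceCtorEq, false_iff]
      exact fun h => ha ((h.apply_eq_self_iff).2 hb)
    · simp only [φ, ha, hb, if_false, Sum.inl.injEq]
      exact (sameCycle_iff_cycleOf_eq_of_mem_support (mem_support.2 ha) (mem_support.2 hb)).symm
  let T : Finset (Perm (Fin n) ⊕ Fin n) := Finset.univ.image φ
  have hT : T = p.cycleFactorsFinset.disjSum (Finset.univ.filter fun a => p a = a) := by
    ext z
    rcases z with c | a
    · simp only [T, Finset.mem_image, Finset.mem_univ, true_and, Finset.inl_mem_disjSum]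
      constructor
      · rintro ⟨a, ha⟩
        by_cases h : p a = a
        · simp [φ, h] at ha
        · simp only [φ, h, if_false, Sum.inl.injEq] at ha
          rw [← ha, cycleOf_mem_cycleFactorsFinset_iff, mem_support]
          exact h
      · intro hc
        obtain ⟨a, ha⟩ := (mem_cycleFactorsFinset_iff.1 hc).1.nonempty_support
        refine ⟨a, ?_⟩
        have hpa : p a ≠ a := mem_support.1 (mem_cycleFactorsFinset_support_le hc ha)
        simp only [φ, hpa, if_false, Sum.inl.injEq]
        exact (cycle_is_cycleOf ha hc).symm
    · simp only [T, Finset.mem_image, Finset.mem_univ, true_and, Finset.inr_mem_disjSum,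
        Finset.mem_filter]
      constructor
      · rintro ⟨b, hb⟩
        by_cases h : p b = b
        · simp only [φ, h, if_true, Sum.inr.injEq] at hb
          exact hb ▸ h
        · simp [φ, h] at hb
      · intro ha
        exact ⟨a, by simp [φ, ha]⟩
  have hcard : T.card = numCycles p := by
    rw [hT, Finset.card_disjSum, numCycles_eq]
    congr 1
    have h1 : (Finset.univ.filter fun a => p a = a) = p.supportᶜ := by
      ext a; simp
    rw [h1, Finset.card_compl, Fintype.card_fin]
  let φ' : Fin n → T := fun a => ⟨φ a, Finset.mem_image_of_mem _ (Finset.mem_univ _)⟩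
  have hφ' : Function.Surjective φ' := by
    rintro ⟨z, hz⟩
    obtain ⟨a, -, ha⟩ := Finset.mem_image.1 hz
    exact ⟨a, Subtype.ext ha⟩
  have himg : (Finset.univ.filter fun f : Fin n → Fin x => ∀ a, f (p a) = f a) =
      (Finset.univ : Finset (T → Fin x)).image fun g => g ∘ φ' := by
    ext f
    simp only [Finset.mem_filter, Finset.mem_univ, true_and, Finset.mem_image]
    constructor
    · intro hf
      refine ⟨fun t => f (hφ' t).choose, funext fun a => ?_⟩
      refine apply_eq_of_sameCycle hf ((hφ _ _).1 ?_)
      exact congrArg Subtype.val (hφ' (φ' a)).choose_spec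
    · rintro ⟨g, rfl⟩ a
      have : φ' (p a) = φ' a := Subtype.ext ((hφ _ _).2 (SameCycle.refl p a).apply_left)
      simp only [Function.comp_apply, this]
  rw [himg, Finset.card_image_of_injective _ hφ'.injective_comp_right]
  simp [hcard]

/-- Joining a fixed point `a` to the cycle of another point lowers the number of cycles by one. -/
lemma numCycles_mul_swap {p : Perm (Fin n)} {a s : Fin n} (ha : p a = a) (hs : s ≠ a) :
    numCycles (p * swap a s) + 1 = numCycles p := by
  classical
  -- Compare invariant 2-colourings: those of `p * swap a s` are those of `p` with `f a = f s`,
  -- while `p` leaves the colour of its fixed point `a` free.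
  have key : 2 ^ numCycles (p * swap a s) * 2 = 2 ^ numCycles p := by
    rw [← card_invariant_colorings 2 p, ← card_invariant_colorings 2 (p * swap a s)]
    have hiff : ∀ f : Fin n → Fin 2, (∀ y, f ((p * swap a s) y) = f y) ↔
        (∀ y, f (p y) = f y) ∧ f a = f s := by
      intro f
      simp only [Perm.mul_apply]
      constructor
      · intro h
        have h1 := h s
        have h2 := h a
        rw [swap_apply_right, ha] at h1
        rw [swap_apply_left] at h2
        refine ⟨fun y => ?_, h1⟩
        by_cases hya : y = a
        · rw [hya, ha]
        by_cases hys : y = s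
        · rw [hys, h2, h1]
        · have h3 := h y
          rwa [swap_apply_of_ne_of_ne hya hys] at h3
      · rintro ⟨h, has⟩ y
        rw [h]
        by_cases hya : y = a
        · rw [hya, swap_apply_left, has]
        by_cases hys : y = s
        · rw [hys, swap_apply_right, has]
        · rw [swap_apply_of_ne_of_ne hya hys]
    have hpne : ∀ y, y ≠ a → p y ≠ a := fun y hy h => hy (p.injective (h.trans ha.symm))
    have hcard : (Finset.univ.filter fun f : Fin n → Fin 2 =>
        ∀ y, f ((p * swap a s) y) = f y).card * (Finset.univ : Finset (Fin 2)).card =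
        (Finset.univ.filter fun f : Fin n → Fin 2 => ∀ y, f (p y) = f y).card := by
      rw [← Finset.card_product]
      refine Finset.card_bij' (fun z _ => Function.update z.1 a z.2)
        (fun f _ => (Function.update f a (f s), f a)) ?_ ?_ ?_ ?_
      · rintro ⟨f, c⟩ hf
        simp only [Finset.mem_product, Finset.mem_filter, Finset.mem_univ, true_and, and_true,
          hiff] at hf
        simp only [Finset.mem_filter, Finset.mem_univ, true_and]
        intro y
        by_cases hya : y = a
        · rw [hya, ha]
        · rw [Function.update_of_ne hya, Function.update_of_ne (hpne y hya), hf.1]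
      · intro f hf
        simp only [Finset.mem_filter, Finset.mem_univ, true_and] at hf
        simp only [Finset.mem_product, Finset.mem_filter, Finset.mem_univ, true_and, and_true,
          hiff]
        refine ⟨fun y => ?_, by simp [hs]⟩
        by_cases hya : y = a
        · rw [hya, ha]
        · rw [Function.update_of_ne hya, Function.update_of_ne (hpne y hya), hf]
      · rintro ⟨f, c⟩ hf
        simp only [Finset.mem_product, Finset.mem_filter, Finset.mem_univ, true_and, and_true,
          hiff] at hf
        simp [Function.update_of_ne hs, ← hf.2]
      · intro f hf
        simp
    simpa using hcard
  rw [← pow_succ] at key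
  exact Nat.pow_right_injective le_rfl key

end Cycles

end FoulkesCarries
end

noncomputable section
namespace FoulkesCarries

open Equiv Equiv.Perm

/-! ### Hook symmetrizers -/

section Hooks

variable {n : ℕ}

/-- The permutations that fix every point outside `S`. -/
def permsOn (S : Finset (Fin n)) : Finset (Perm (Fin n)) :=
  Finset.univ.filter fun p => ∀ x, x ∉ S → p x = x

lemma mem_permsOn {S : Finset (Fin n)} {p : Perm (Fin n)} :
    p ∈ permsOn S ↔ ∀ x, x ∉ S → p x = x := by simp [permsOn]

lemma permsOn_mul {S : Finset (Fin n)} {p q : Perm (Fin n)} (hp : p ∈ permsOn S)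
    (hq : q ∈ permsOn S) : p * q ∈ permsOn S := by
  rw [mem_permsOn] at *
  intro x hx
  rw [Perm.mul_apply, hq x hx, hp x hx]

lemma permsOn_inv {S : Finset (Fin n)} {p : Perm (Fin n)} (hp : p ∈ permsOn S) :
    p⁻¹ ∈ permsOn S := by
  rw [mem_permsOn] at *
  intro x hx
  rw [inv_eq_iff_eq, hp x hx]

lemma permsOn_apply_mem {S : Finset (Fin n)} {p : Perm (Fin n)} (hp : p ∈ permsOn S)
    {x : Fin n} (hx : x ∈ S) : p x ∈ S := by
  by_contra h
  have h1 := mem_permsOn.1 hp _ h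
  rw [EmbeddingLike.apply_eq_iff_eq] at h1
  exact h (h1.symm ▸ hx)

lemma swap_mem_permsOn {S : Finset (Fin n)} {a b : Fin n} (ha : a ∈ S) (hb : b ∈ S) :
    swap a b ∈ permsOn S := by
  rw [mem_permsOn]
  intro x hx
  exact swap_apply_of_ne_of_ne (fun h => hx (h ▸ ha)) (fun h => hx (h ▸ hb))

/-- The sum in `ℂ[S_n]` of the permutations that move only points of `S`. -/
def symSum (S : Finset (Fin n)) : SymAlg n :=
  ∑ p ∈ permsOn S, MonoidAlgebra.of ℂ (Perm (Fin n)) p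

/-- The signed sum in `ℂ[S_n]` of the permutations that move only points of `S`. -/
def altSum (S : Finset (Fin n)) : SymAlg n :=
  ∑ p ∈ permsOn S, ((sign p : ℤ) : ℂ) • MonoidAlgebra.of ℂ (Perm (Fin n)) p

lemma of_mul_symSum {S : Finset (Fin n)} {q : Perm (Fin n)} (hq : q ∈ permsOn S) :
    MonoidAlgebra.of ℂ _ q * symSum S = symSum S := by
  rw [symSum, Finset.mul_sum]
  refine Finset.sum_nbij' (fun p => q * p) (fun p => q⁻¹ * p) ?_ ?_ ?_ ?_ ?_
  · exact fun p hp => permsOn_mul hq hp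
  · exact fun p hp => permsOn_mul (permsOn_inv hq) hp
  · intro p _; simp
  · intro p _; simp
  · intro p _; rw [map_mul]

lemma sign_cast_mul_self (q : Perm (Fin n)) :
    ((sign q : ℤ) : ℂ) * ((sign q : ℤ) : ℂ) = 1 := by
  rw [← Int.cast_mul, ← Units.val_mul, Int.units_mul_self]; simp

lemma altSum_mul_of {S : Finset (Fin n)} {q : Perm (Fin n)} (hq : q ∈ permsOn S) :
    altSum S * MonoidAlgebra.of ℂ _ q = ((sign q : ℤ) : ℂ) • altSum S := by
  rw [altSum, Finset.sum_mul, Finset.smul_sum]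
  refine Finset.sum_nbij' (fun p => p * q) (fun p => p * q⁻¹) ?_ ?_ ?_ ?_ ?_
  · exact fun p hp => permsOn_mul hp hq
  · exact fun p hp => permsOn_mul hp (permsOn_inv hq)
  · intro p _; simp
  · intro p _; simp
  · intro p _
    rw [map_mul, smul_smul, smul_mul_assoc, Units.val_mul, Int.cast_mul, mul_left_comm,
      sign_cast_mul_self, mul_one, map_mul]

/-- The Young symmetrizer of the hook whose column is `A ∪ {o}` and whose row is the complement of
`A`. -/
def hookElt (o : Fin n) (A : Finset (Fin n)) : SymAlg n := altSum (insert o A) * symSum Aᶜ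

lemma hookElt_eq_sum (o : Fin n) (A : Finset (Fin n)) :
    hookElt o A = ∑ c ∈ permsOn (insert o A), ∑ d ∈ permsOn Aᶜ,
      MonoidAlgebra.single (c * d) ((sign c : ℤ) : ℂ) := by
  rw [hookElt, altSum, symSum, Finset.sum_mul]
  refine Finset.sum_congr rfl fun c _ => ?_
  rw [Finset.mul_sum]
  refine Finset.sum_congr rfl fun d _ => ?_
  simp [MonoidAlgebra.single_mul_single]

lemma coeff_one_mul_hookElt (o : Fin n) (A : Finset (Fin n)) (u : SymAlg n) :
    (u * hookElt o A).coeff 1 = ∑ c ∈ permsOn (insert o A), ∑ d ∈ permsOn Aᶜ,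
      ((sign c : ℤ) : ℂ) * u.coeff (c * d)⁻¹ := by
  rw [hookElt_eq_sum, Finset.mul_sum, MonoidAlgebra.coeff_sum, Finset.sum_apply']
  refine Finset.sum_congr rfl fun c _ => ?_
  rw [Finset.mul_sum, MonoidAlgebra.coeff_sum, Finset.sum_apply']
  refine Finset.sum_congr rfl fun d _ => ?_
  rw [MonoidAlgebra.coeff_mul_single_apply, one_mul, mul_comm]

lemma coeff_hookElt (o : Fin n) (A : Finset (Fin n)) (g : Perm (Fin n)) :
    (hookElt o A).coeff g = ∑ c ∈ permsOn (insert o A), ∑ d ∈ permsOn Aᶜ,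
      if c * d = g then ((sign c : ℤ) : ℂ) else 0 := by
  rw [hookElt_eq_sum, MonoidAlgebra.coeff_sum, Finset.sum_apply']
  refine Finset.sum_congr rfl fun c _ => ?_
  rw [MonoidAlgebra.coeff_sum, Finset.sum_apply']
  refine Finset.sum_congr rfl fun d _ => ?_
  rw [MonoidAlgebra.coeff_single, Finsupp.single_apply]

/-- The row and the column of the hook share only the box `o`, so their groups meet trivially. This
normalizes `hookElt` to have coefficient `1` at the identity. -/
lemma permsOn_inter {o : Fin n} {A : Finset (Fin n)} {c d : Perm (Fin n)}
    (hc : c ∈ permsOn (insert o A)) (hd : d ∈ permsOn Aᶜ) (h : c * d = 1) : c = 1 ∧ d = 1 := by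
  have hcd : d = c⁻¹ := (inv_eq_of_mul_eq_one_right h).symm
  rw [mem_permsOn] at hc hd
  have hd1 : d = 1 := by
    have hA : ∀ x ∈ A, d x = x := fun x hx => hd x (by simpa using hx)
    have hB : ∀ x, x ∉ insert o A → d x = x := by
      intro x hx
      rw [hcd, inv_eq_iff_eq, hc x hx]
    have ho : d o = o := by
      by_contra hne
      by_cases h1 : d o ∈ A
      · exact hne (d.injective (hA _ h1))
      · exact hne (d.injective (hB _ (by simp [h1, hne])))
    ext x
    by_cases h1 : x ∈ A
    · simp [hA x h1]
    by_cases h2 : x = o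
    · simp [h2, ho]
    · simp [hB x (by simp [h1, h2])]
  exact ⟨by simpa [hd1] using h, hd1⟩

lemma coeff_one_hookElt (o : Fin n) (A : Finset (Fin n)) : (hookElt o A).coeff 1 = 1 := by
  have h1 : ∀ S : Finset (Fin n), (1 : Perm (Fin n)) ∈ permsOn S := fun S => by
    simp [mem_permsOn]
  rw [coeff_hookElt, Finset.sum_eq_single_of_mem 1 (h1 _), Finset.sum_eq_single_of_mem 1 (h1 _)]
  · simp
  · intro d hd hd1
    rw [if_neg]
    simpa using hd1
  · intro c hc hc1
    refine Finset.sum_eq_zero fun d hd => if_neg fun h => hc1 ?_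
    exact (permsOn_inter hc hd h).1

/-- Von Neumann's lemma for hooks. -/
lemma altSum_mul_of_mul_symSum {o : Fin n} {A : Finset (Fin n)} (ho : o ∉ A) (x : Perm (Fin n)) :
    ∃ s : ℂ, altSum (insert o A) * MonoidAlgebra.of ℂ _ x * symSum Aᶜ = s • hookElt o A := by
  -- If two column points come from the row, their transposition can be absorbed on the left with
  -- sign `-1` and on the right with sign `1`, so the product is zero.
  by_cases hex : ∃ p ∈ insert o A, ∃ q ∈ insert o A, p ≠ q ∧ x⁻¹ p ∈ Aᶜ ∧ x⁻¹ q ∈ Aᶜ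
  · obtain ⟨p, hp, q, hq, hpq, hxp, hxq⟩ := hex
    refine ⟨0, ?_⟩
    have h1 := altSum_mul_of (swap_mem_permsOn hp hq)
    have h2 := of_mul_symSum (swap_mem_permsOn hxp hxq)
    have h3 : x * swap (x⁻¹ p) (x⁻¹ q) = swap p q * x := by
      rw [mul_swap_eq_swap_mul]; simp
    rw [sign_swap hpq] at h1
    have h4 : altSum (insert o A) * MonoidAlgebra.of ℂ _ x * symSum Aᶜ =
        -(altSum (insert o A) * MonoidAlgebra.of ℂ _ x * symSum Aᶜ) := by
      calc altSum (insert o A) * MonoidAlgebra.of ℂ _ x * symSum Aᶜ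
          = altSum (insert o A) * MonoidAlgebra.of ℂ _ x *
            (MonoidAlgebra.of ℂ _ (swap (x⁻¹ p) (x⁻¹ q)) * symSum Aᶜ) := by rw [h2]
        _ = altSum (insert o A) * MonoidAlgebra.of ℂ _ (x * swap (x⁻¹ p) (x⁻¹ q)) *
            symSum Aᶜ := by rw [map_mul]; simp only [mul_assoc]
        _ = altSum (insert o A) * MonoidAlgebra.of ℂ _ (swap p q) * MonoidAlgebra.of ℂ _ x *
            symSum Aᶜ := by rw [h3, map_mul]; simp only [mul_assoc]
        _ = _ := by rw [h1]; simp [mul_assoc]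
    rw [zero_smul]
    have h5 := eq_neg_iff_add_eq_zero.1 h4
    rw [← two_smul ℂ] at h5
    exact (smul_eq_zero.1 h5).resolve_left two_ne_zero
  · have hcard : (insert o A).card = A.card + 1 := Finset.card_insert_of_notMem ho
    let Y := (insert o A).image fun p => x⁻¹ p
    have hY : Y.card = A.card + 1 := by
      rw [Finset.card_image_of_injective _ (x⁻¹).injective, hcard]
    have hYB : (Y \ A).card ≤ 1 := by
      rw [Finset.card_le_one]
      intro a ha b hb
      simp only [Y, Finset.mem_sdiff, Finset.mem_image] at ha hb
      obtain ⟨⟨p, hp, rfl⟩, hpA⟩ := ha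
      obtain ⟨⟨q, hq, rfl⟩, hqA⟩ := hb
      by_contra hne
      exact hex ⟨p, hp, q, hq, fun h => hne (by rw [h]), by simpa using hpA, by simpa using hqA⟩
    have hle : A.card ≤ (Y ∩ A).card := by
      have := Finset.card_sdiff_add_card_inter Y A
      omega
    have hAY : A ⊆ Y := by
      have := Finset.eq_of_subset_of_card_le (Finset.inter_subset_right (s₁ := Y)) hle
      rw [← this]
      exact Finset.inter_subset_left
    have hne : (Y \ A).Nonempty := by
      rw [← Finset.card_pos, Finset.card_sdiff_of_subset hAY]
      omega
    obtain ⟨y, hy⟩ := hne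
    rw [Finset.mem_sdiff] at hy
    have hmemY : ∀ z, z ∈ Y ↔ x z ∈ insert o A := by
      intro z
      simp only [Y, Finset.mem_image]
      constructor
      · rintro ⟨p, hp, rfl⟩; simpa using hp
      · exact fun h => ⟨x z, h, by simp⟩
    -- Here `x⁻¹` maps the column onto `A ∪ {y}` with `y` in the row. Correcting by the row
    -- transposition of `o` and `y` makes `x * t` preserve the column, so it splits into a column
    -- and a row permutation.
    let t := swap o y
    have htR : t ∈ permsOn Aᶜ := swap_mem_permsOn (by simpa using ho) (by simpa using hy.2)
    have hpres : ∀ z ∈ insert o A, (x * t) z ∈ insert o A := by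
      intro z hz
      rw [Perm.mul_apply]
      rcases Finset.mem_insert.1 hz with rfl | hz
      · rw [swap_apply_left]; exact (hmemY _).1 hy.1
      · have h1 : t z = z := mem_permsOn.1 htR z (by simpa using hz)
        rw [h1]; exact (hmemY _).1 (hAY hz)
    have hpres' : ∀ z, (x * t) z ∈ insert o A ↔ z ∈ insert o A := by
      intro z
      refine ⟨fun h => ?_, hpres z⟩
      have himg : (insert o A).image (x * t) = insert o A :=
        Finset.eq_of_subset_of_card_le
          (fun w hw => by obtain ⟨z, hz, rfl⟩ := Finset.mem_image.1 hw; exact hpres z hz)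
          (by rw [Finset.card_image_of_injective _ (x * t).injective])
      rw [← himg] at h
      obtain ⟨w, hw, hwz⟩ := Finset.mem_image.1 h
      exact (x * t).injective hwz ▸ hw
    let c : Perm (Fin n) := ofSubtype ((x * t).subtypePerm (p := fun z => z ∈ insert o A) hpres')
    have hcC : c ∈ permsOn (insert o A) := by
      rw [mem_permsOn]
      intro z hz
      exact ofSubtype_apply_of_not_mem _ hz
    have hcx : ∀ z ∈ insert o A, c z = (x * t) z := by
      intro z hz
      rw [ofSubtype_apply_of_mem _ hz]
      rfl
    let b := c⁻¹ * (x * t)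
    have hbR : b ∈ permsOn Aᶜ := by
      rw [mem_permsOn]
      intro z hz
      have hz' : z ∈ insert o A := Finset.mem_insert_of_mem (by simpa using hz)
      simp only [b]
      rw [Perm.mul_apply, inv_eq_iff_eq, hcx z hz']
    have hx : x = c * (b * t⁻¹) := by simp only [b]; group
    refine ⟨((sign c : ℤ) : ℂ), ?_⟩
    rw [hx, map_mul, ← mul_assoc, altSum_mul_of hcC, mul_assoc,
      of_mul_symSum (permsOn_mul hbR (permsOn_inv htR)), hookElt, smul_mul_assoc]

/-- The scalar by which a central element acts on the hook symmetrizer. -/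
def hookScalar (o : Fin n) (A : Finset (Fin n)) (u : SymAlg n) : ℂ := (u * hookElt o A).coeff 1

/-- A central `u` can be moved between the alternating and the symmetric sum, where von Neumann's
lemma applies by linearity. The scalar is then read off at the identity. -/
lemma mul_hookElt {o : Fin n} {A : Finset (Fin n)} (ho : o ∉ A) {u : SymAlg n}
    (hu : u ∈ Subalgebra.center ℂ (SymAlg n)) :
    u * hookElt o A = hookScalar o A u • hookElt o A := by
  have key : ∀ z : SymAlg n, ∃ s : ℂ,
      altSum (insert o A) * z * symSum Aᶜ = s • hookElt o A := by
    intro z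
    induction z using MonoidAlgebra.induction_on with
    | of g => exact altSum_mul_of_mul_symSum ho g
    | add z w hz hw =>
      obtain ⟨s, hs⟩ := hz
      obtain ⟨t, ht⟩ := hw
      exact ⟨s + t, by rw [mul_add, add_mul, hs, ht, add_smul]⟩
    | smul r z hz =>
      obtain ⟨s, hs⟩ := hz
      exact ⟨r * s, by rw [mul_smul_comm, smul_mul_assoc, hs, smul_smul]⟩
  obtain ⟨s, hs⟩ := key u
  have h1 : u * hookElt o A = s • hookElt o A := by
    rw [← hs, hookElt, ← mul_assoc, Subalgebra.mem_center_iff.1 hu]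
  have h2 : hookScalar o A u = s := by
    rw [hookScalar, h1, MonoidAlgebra.coeff_smul_apply, coeff_one_hookElt, smul_eq_mul, mul_one]
  rw [h1, h2]

lemma hookScalar_mul {o : Fin n} {A : Finset (Fin n)} (ho : o ∉ A) {u v : SymAlg n}
    (hu : u ∈ Subalgebra.center ℂ (SymAlg n)) (hv : v ∈ Subalgebra.center ℂ (SymAlg n)) :
    hookScalar o A (u * v) = hookScalar o A u * hookScalar o A v := by
  rw [hookScalar, mul_assoc, mul_hookElt ho hv, mul_smul_comm, mul_hookElt ho hu, smul_smul,
    MonoidAlgebra.coeff_smul_apply, coeff_one_hookElt, smul_eq_mul, mul_one, mul_comm]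

end Hooks

end FoulkesCarries
end

noncomputable section
namespace FoulkesCarries

open Equiv Equiv.Perm

/-! ### Scalars of central elements on hooks: content products -/

section HookSums

variable {n : ℕ}

/-- The transpositions `swap a s`, with the identity at `s = a`, are coset representatives; `s` is
recovered from `q` as `q⁻¹ a`. -/
lemma sum_permsOn_insert {M : Type*} [AddCommMonoid M] {S : Finset (Fin n)} {a : Fin n}
    (ha : a ∉ S) (F : Perm (Fin n) → M) :
    ∑ p ∈ permsOn (insert a S), F p =
      ∑ p ∈ permsOn S, ∑ s ∈ insert a S, F (p * swap a s) := by
  rw [← Finset.sum_product']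
  symm
  have hmono : ∀ p ∈ permsOn S, p ∈ permsOn (insert a S) := fun p hp => by
    rw [mem_permsOn] at *
    exact fun x hx => hp x fun h => hx (Finset.mem_insert_of_mem h)
  refine Finset.sum_bij' (fun z _ => z.1 * swap a z.2) (fun q _ => (q * swap a (q⁻¹ a), q⁻¹ a))
    ?_ ?_ ?_ ?_ ?_
  · rintro ⟨p, s⟩ h
    rw [Finset.mem_product] at h
    exact permsOn_mul (hmono p h.1) (swap_mem_permsOn (Finset.mem_insert_self _ _) h.2)
  · intro q hq
    rw [Finset.mem_product]
    have h1 : q⁻¹ a ∈ insert a S :=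
      permsOn_apply_mem (permsOn_inv hq) (Finset.mem_insert_self _ _)
    refine ⟨?_, h1⟩
    have h2 := permsOn_mul hq (swap_mem_permsOn (Finset.mem_insert_self a S) h1)
    rw [mem_permsOn] at h2 ⊢
    intro x hx
    by_cases hxa : x = a
    · simp [hxa]
    · exact h2 x (by simp [hxa, hx])
  · rintro ⟨p, s⟩ h
    rw [Finset.mem_product] at h
    have h1 : p.symm a = a := mem_permsOn.1 (permsOn_inv h.1) a ha
    simp [mul_assoc, h1]
  · intro q hq
    simp [mul_assoc]
  · intro z _; rfl

/-- The cycle count generating function of a hook symmetrizer. -/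
def hookPoly (o : Fin n) (A B : Finset (Fin n)) : Polynomial ℂ :=
  ∑ c ∈ permsOn (insert o A), ∑ d ∈ permsOn (insert o B),
    ((sign c : ℤ) : ℂ) • Polynomial.X ^ numCycles (c * d)

open Polynomial in
-- Lengthening the column by a new point `a`: the term `s = a` keeps `a` fixed, and each of the
-- `A.card + 1` others joins `a` to a cycle, losing one cycle and changing the sign. The factor `X`
-- avoids dividing. Lengthening the row works the same way without the sign.
lemma X_mul_hookPoly_insert_left {o a : Fin n} {A B : Finset (Fin n)} (ho : o ∉ A)
    (ha : a ∉ insert o A) (haB : a ∉ insert o B) :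
    X * hookPoly o (insert a A) B = (X - C ((A.card + 1 : ℕ) : ℂ)) * hookPoly o A B := by
  rw [hookPoly, Finset.insert_comm, sum_permsOn_insert ha, hookPoly, Finset.mul_sum,
    Finset.mul_sum]
  refine Finset.sum_congr rfl fun c hc => ?_
  rw [Finset.sum_comm, Finset.mul_sum, Finset.mul_sum]
  refine Finset.sum_congr rfl fun d hd => ?_
  rw [Finset.sum_insert ha, swap_self, sub_mul, mul_add, sub_eq_add_neg]
  congr 1
  have hca : c a = a := mem_permsOn.1 hc a ha
  have hda : d a = a := mem_permsOn.1 hd a haB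
  have hterm : ∀ s ∈ insert o A, X * (((sign (c * swap a s) : ℤ) : ℂ) •
      (X : ℂ[X]) ^ numCycles (c * swap a s * d)) =
      -(((sign c : ℤ) : ℂ) • X ^ numCycles (c * d)) := by
    intro s hs
    have hsa : s ≠ a := fun h => ha (h ▸ hs)
    have h1 : numCycles (c * swap a s * d) + 1 = numCycles (c * d) := by
      rw [numCycles_mul_comm, ← mul_assoc, numCycles_mul_swap (by simp [hca, hda]) hsa,
        numCycles_mul_comm]
    rw [← h1, Perm.sign_mul, sign_swap hsa.symm, mul_smul_comm, pow_succ']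
    simp
  rw [Finset.mul_sum, Finset.sum_congr rfl hterm, Finset.sum_const,
    Finset.card_insert_of_notMem ho]
  simp only [nsmul_eq_mul, mul_neg]
  simp

open Polynomial in
lemma X_mul_hookPoly_insert_right {o a : Fin n} {A B : Finset (Fin n)} (ho : o ∉ B)
    (ha : a ∉ insert o A) (haB : a ∉ insert o B) :
    X * hookPoly o A (insert a B) = (X + C ((B.card + 1 : ℕ) : ℂ)) * hookPoly o A B := by
  rw [hookPoly, Finset.insert_comm, hookPoly, Finset.mul_sum, Finset.mul_sum]
  refine Finset.sum_congr rfl fun c hc => ?_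
  rw [sum_permsOn_insert haB, Finset.mul_sum, Finset.mul_sum]
  refine Finset.sum_congr rfl fun d hd => ?_
  rw [Finset.sum_insert haB, swap_self, add_mul, mul_add]
  congr 1
  have hca : c a = a := mem_permsOn.1 hc a ha
  have hda : d a = a := mem_permsOn.1 hd a haB
  have hterm : ∀ s ∈ insert o B, X * (((sign c : ℤ) : ℂ) •
      (X : ℂ[X]) ^ numCycles (c * (d * swap a s))) =
      ((sign c : ℤ) : ℂ) • X ^ numCycles (c * d) := by
    intro s hs
    have hsa : s ≠ a := fun h => haB (h ▸ hs)
    have h1 : numCycles (c * (d * swap a s)) + 1 = numCycles (c * d) := by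
      rw [← mul_assoc, numCycles_mul_swap (by simp [hca, hda]) hsa]
    rw [← h1, mul_smul_comm, pow_succ']
  rw [Finset.mul_sum, Finset.sum_congr rfl hterm, Finset.sum_const,
    Finset.card_insert_of_notMem ho]
  simp

lemma permsOn_singleton (o : Fin n) : permsOn {o} = {1} := by
  ext p
  rw [mem_permsOn, Finset.mem_singleton]
  refine ⟨fun h => ?_, fun h => by simp [h]⟩
  have ho : p o = o := by
    by_contra hne
    exact hne (p.injective (h (p o) (by simpa using hne)))
  ext x
  by_cases hx : x = o
  · simp [hx, ho]
  · simp [h x (by simpa using hx)]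

open Polynomial in
lemma X_pow_mul_hookPoly {o : Fin n} (A B : Finset (Fin n)) (hoA : o ∉ A) (hoB : o ∉ B)
    (hAB : Disjoint A B) :
    X ^ (A.card + B.card) * hookPoly o A B = X ^ n *
      ((∏ k ∈ Finset.range A.card, (X - C ((k + 1 : ℕ) : ℂ))) *
        ∏ k ∈ Finset.range B.card, (X + C ((k + 1 : ℕ) : ℂ))) := by
  induction A using Finset.induction_on with
  | empty =>
    clear hAB
    induction B using Finset.induction_on with
    | empty => simp [hookPoly, permsOn_singleton, numCycles_one]
    | insert a B ha ih =>
      simp only [Finset.mem_insert, not_or] at hoB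
      have h1 := X_mul_hookPoly_insert_right (o := o) (a := a) (A := ∅) (B := B) hoB.2
        (by simpa using Ne.symm hoB.1) (by simp [Ne.symm hoB.1, ha])
      have h2 := ih hoB.2
      rw [Finset.card_insert_of_notMem ha, Finset.prod_range_succ]
      calc X ^ ((∅ : Finset (Fin n)).card + (B.card + 1)) * hookPoly o ∅ (insert a B)
          = X ^ ((∅ : Finset (Fin n)).card + B.card) * (X * hookPoly o ∅ (insert a B)) := by ring
        _ = (X + C ((B.card + 1 : ℕ) : ℂ)) *
            (X ^ ((∅ : Finset (Fin n)).card + B.card) * hookPoly o ∅ B) := by rw [h1]; ring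
        _ = _ := by rw [h2]; ring
  | insert a A ha ih =>
    simp only [Finset.mem_insert, not_or] at hoA
    rw [Finset.disjoint_insert_left] at hAB
    have h1 := X_mul_hookPoly_insert_left (o := o) (a := a) (A := A) (B := B) hoA.2
      (by simp [Ne.symm hoA.1, ha]) (by simp [Ne.symm hoA.1, hAB.1])
    have h2 := ih hoA.2 hAB.2
    rw [Finset.card_insert_of_notMem ha, Finset.prod_range_succ]
    calc X ^ ((A.card + 1) + B.card) * hookPoly o (insert a A) B
        = X ^ (A.card + B.card) * (X * hookPoly o (insert a A) B) := by ring
      _ = (X - C ((A.card + 1 : ℕ) : ℂ)) * (X ^ (A.card + B.card) * hookPoly o A B) := by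
          rw [h1]; ring
      _ = _ := by rw [h2]; ring

open Polynomial in
-- The product of `X + content` over the boxes of the hook: content `0` at the corner, negative down
-- the column, positive along the row.
lemma hookPoly_eq {o : Fin n} {A : Finset (Fin n)} (ho : o ∉ A) :
    hookPoly o A (Aᶜ.erase o) = X * ((∏ k ∈ Finset.range A.card, (X - C ((k + 1 : ℕ) : ℂ))) *
        ∏ k ∈ Finset.range (n - 1 - A.card), (X + C ((k + 1 : ℕ) : ℂ))) := by
  have h := X_pow_mul_hookPoly (o := o) A (Aᶜ.erase o) ho (by simp)
    (Disjoint.mono_right (Finset.erase_subset _ _) disjoint_compl_right)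
  have hc : (Aᶜ.erase o).card = n - 1 - A.card := by
    rw [Finset.card_erase_of_mem (by simpa using ho), Finset.card_compl, Fintype.card_fin]
    omega
  have hlt : A.card < n := by
    have := Finset.card_lt_univ_of_notMem ho
    rwa [Fintype.card_fin] at this
  rw [hc] at h
  have e1 : A.card + (n - 1 - A.card) = n - 1 := by omega
  rw [e1] at h
  have e2 : (X : ℂ[X]) ^ n = X ^ (n - 1) * X := by
    rw [← pow_succ]; congr 1; omega
  rw [e2, mul_assoc] at h
  exact mul_left_cancel₀ (pow_ne_zero _ X_ne_zero) h

/-- The element of `ℂ[S_n]` with coefficients `f`. -/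
def classElt (f : Perm (Fin n) → ℂ) : SymAlg n := ∑ g, MonoidAlgebra.single g (f g)

@[simp] lemma coeff_classElt (f : Perm (Fin n) → ℂ) (g : Perm (Fin n)) :
    (classElt f).coeff g = f g := by
  rw [classElt, MonoidAlgebra.coeff_sum, Finset.sum_apply']
  simp [Finsupp.single_apply]

lemma mem_center_iff_coeff {u : SymAlg n} : u ∈ Subalgebra.center ℂ (SymAlg n) ↔
    ∀ g h : Perm (Fin n), u.coeff (g * h) = u.coeff (h * g) := by
  rw [Subalgebra.mem_center_iff]
  constructor
  · intro hu g h
    have := congrArg (fun z => z.coeff (h * g * h)) (hu (MonoidAlgebra.single h 1))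
    simpa [MonoidAlgebra.coeff_single_mul_apply, MonoidAlgebra.coeff_mul_single_apply, mul_assoc]
      using this
  · intro hu b
    induction b using MonoidAlgebra.induction_on with
    | of g =>
      ext x
      simp only [MonoidAlgebra.of_apply, MonoidAlgebra.coeff_single_mul_apply,
        MonoidAlgebra.coeff_mul_single_apply, one_mul, mul_one]
      exact hu _ _
    | add z w hz hw => rw [add_mul, mul_add, hz, hw]
    | smul r z hz => rw [smul_mul_assoc, mul_smul_comm, hz]

lemma classElt_mem_center {f : Perm (Fin n) → ℂ} (hf : ∀ p q, numCycles p = numCycles q → f p = f q) :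
    classElt f ∈ Subalgebra.center ℂ (SymAlg n) := by
  rw [mem_center_iff_coeff]
  intro g h
  rw [coeff_classElt, coeff_classElt]
  exact hf _ _ (numCycles_mul_comm g h)

lemma hookScalar_classElt {o : Fin n} {A : Finset (Fin n)} (ho : o ∉ A) (F : ℕ → ℂ) :
    hookScalar o A (classElt fun g => F (numCycles g)) =
      ∑ c ∈ permsOn (insert o A), ∑ d ∈ permsOn (insert o (Aᶜ.erase o)),
        ((sign c : ℤ) : ℂ) * F (numCycles (c * d)) := by
  rw [hookScalar, coeff_one_mul_hookElt, Finset.insert_erase (by simpa using ho)]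
  refine Finset.sum_congr rfl fun c _ => Finset.sum_congr rfl fun d _ => ?_
  rw [coeff_classElt, numCycles_inv]

/-- The sum of the `n`-cycles. -/
def longCycleSum (n : ℕ) : SymAlg n := classElt fun g => if numCycles g = 1 then 1 else 0

/-- The generating element `∑ x ^ ℓ(g) g`. -/
def powElt (n x : ℕ) : SymAlg n := classElt fun g => (x : ℂ) ^ numCycles g

lemma longCycleSum_mem_center : longCycleSum n ∈ Subalgebra.center ℂ (SymAlg n) :=
  classElt_mem_center fun p q h => by rw [h]

lemma powElt_mem_center (x : ℕ) : powElt n x ∈ Subalgebra.center ℂ (SymAlg n) :=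
  classElt_mem_center fun p q h => by rw [h]

/-- The coefficient of `X` in the content product. -/
lemma hookScalar_longCycleSum {o : Fin n} {A : Finset (Fin n)} (ho : o ∉ A) :
    hookScalar o A (longCycleSum n) =
      (-1) ^ A.card * (A.card.factorial * (n - 1 - A.card).factorial : ℂ) := by
  have h : hookScalar o A (longCycleSum n) = (hookPoly o A (Aᶜ.erase o)).coeff 1 := by
    rw [longCycleSum, hookScalar_classElt ho fun k => if k = 1 then 1 else 0, hookPoly,
      Polynomial.finsetSum_coeff]
    refine Finset.sum_congr rfl fun c _ => ?_
    rw [Polynomial.finsetSum_coeff]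
    refine Finset.sum_congr rfl fun d _ => ?_
    simp [Polynomial.coeff_X_pow, eq_comm]
  rw [h, hookPoly_eq ho, Polynomial.coeff_X_mul, Polynomial.coeff_zero_eq_eval_zero,
    Polynomial.eval_mul, Polynomial.eval_prod, Polynomial.eval_prod]
  simp only [Polynomial.eval_sub, Polynomial.eval_add, Polynomial.eval_X, Polynomial.eval_C,
    zero_sub, zero_add]
  rw [Finset.prod_neg, Finset.card_range, mul_assoc, ← Nat.cast_prod, ← Nat.cast_prod,
    Finset.prod_range_add_one_eq_factorial, Finset.prod_range_add_one_eq_factorial]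

/-- The content product at `x` runs over the `n` consecutive integers from `x + n - 1 - r` down to
`x - r`, with `r = A.card`, so it is a falling factorial. -/
lemma hookScalar_powElt {o : Fin n} {A : Finset (Fin n)} (ho : o ∉ A) (x : ℕ) :
    hookScalar o A (powElt n x) = n.factorial * ((x + n - 1 - A.card).choose n : ℂ) := by
  have hlt : A.card < n := by
    have := Finset.card_lt_univ_of_notMem ho
    rwa [Fintype.card_fin] at this
  have h : hookScalar o A (powElt n x) = (hookPoly o A (Aᶜ.erase o)).eval (x : ℂ) := by
    rw [powElt, hookScalar_classElt ho fun k => (x : ℂ) ^ k, hookPoly,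
      Polynomial.eval_finsetSum]
    refine Finset.sum_congr rfl fun c _ => ?_
    rw [Polynomial.eval_finsetSum]
    refine Finset.sum_congr rfl fun d _ => ?_
    simp
  obtain ⟨s, hs⟩ : ∃ s, n = s + (1 + A.card) := ⟨n - (1 + A.card), by omega⟩
  have e1 : x + n - 1 - A.card = x + s := by omega
  have e2 : n - 1 - A.card = s := by omega
  rw [h, hookPoly_eq ho, e1, e2, ← Nat.cast_mul, ← Nat.descFactorial_eq_factorial_mul_choose,
    ← descPochhammer_eval_eq_descFactorial, descPochhammer_eval_eq_prod_range]
  clear h hlt e1 e2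
  generalize A.card = r at hs ⊢
  rw [hs,
    Finset.prod_range_add, Finset.prod_range_add, Finset.prod_range_one,
    ← Finset.prod_range_reflect (fun j => ((x + s : ℕ) : ℂ) - (j : ℂ)) s]
  have h1 : ∀ j ∈ Finset.range s, ((x + s : ℕ) : ℂ) - ((s - 1 - j : ℕ) : ℂ) =
      x + ((j + 1 : ℕ) : ℂ) := by
    intro j hj
    have hj' := Finset.mem_range.1 hj
    have : s = (s - 1 - j) + (j + 1) := by omega
    have h3 : (s : ℂ) = ((s - 1 - j : ℕ) : ℂ) + ((j + 1 : ℕ) : ℂ) := by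
      rw [← Nat.cast_add, ← this]
    rw [Nat.cast_add x s, h3]; ring
  have h2 : ∀ j ∈ Finset.range r, ((x + s : ℕ) : ℂ) - ((s + (1 + j) : ℕ) : ℂ) =
      x - ((j + 1 : ℕ) : ℂ) := by
    intro j _
    push_cast; ring
  rw [Finset.prod_congr rfl h1, Finset.prod_congr rfl h2]
  simp only [Polynomial.eval_mul, Polynomial.eval_prod, Polynomial.eval_sub, Polynomial.eval_add,
    Polynomial.eval_X, Polynomial.eval_C]
  push_cast
  ring

end HookSums

end FoulkesCarries
end

noncomputable section
namespace FoulkesCarries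

open Equiv Equiv.Perm

/-! ### Hooks detect exactly the long cycles; pairing of powers -/

section Vanishing

variable {n : ℕ}

lemma exists_not_sameCycle {p : Perm (Fin n)} (o : Fin n) (hp : numCycles p ≠ 1) :
    ∃ x, ¬ p.SameCycle o x := by
  by_contra! h
  have hc : (Finset.univ.filter fun f : Fin n → Fin 2 => ∀ a, f (p a) = f a).card ≤
      (Finset.univ : Finset (Fin 2)).card := by
    refine Finset.card_le_card_of_injOn (fun f => f o) (fun f _ => Finset.mem_univ _) ?_
    intro f hf g hg hfg
    simp only [Finset.coe_filter, Finset.mem_univ, true_and, Set.mem_ofPred_eq] at hf hg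
    ext1 x
    rw [← apply_eq_of_sameCycle hf (h x), ← apply_eq_of_sameCycle hg (h x)]
    exact hfg
  rw [card_invariant_colorings, Finset.card_univ, Fintype.card_fin] at hc
  have h1 : numCycles p ≤ 1 := (Nat.pow_le_pow_iff_right (le_refl 2)).1 (by simpa using hc)
  have h2 := numCycles_pos (Fin.pos o) p
  omega

/-- The cycle of `x`, as a set of points. -/
def cycleSet (p : Perm (Fin n)) (x : Fin n) : Finset (Fin n) :=
  Finset.univ.filter fun y => p.SameCycle x y

lemma mem_cycleSet {p : Perm (Fin n)} {x y : Fin n} :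
    y ∈ cycleSet p x ↔ p.SameCycle x y := by simp [cycleSet]

lemma sign_cycleOf_eq (p : Perm (Fin n)) (x : Fin n) :
    ((sign (p.cycleOf x) : ℤ) : ℂ) = -(-1) ^ (cycleSet p x).card := by
  by_cases hx : p x = x
  · have h1 : cycleSet p x = {x} := by
      ext y
      rw [mem_cycleSet, Finset.mem_singleton]
      exact ⟨fun h => (h.eq_of_left hx).symm, fun h => h ▸ SameCycle.refl _ _⟩
    rw [h1, (cycleOf_eq_one_iff p).2 hx]
    simp
  · have h1 : cycleSet p x = (p.cycleOf x).support := by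
      ext y
      rw [mem_cycleSet, mem_support_cycleOf_iff' hx]
    rw [h1, (isCycle_cycleOf p hx).sign]
    simp

/-- A cycle of `σ` that enters `A` could leave it only through `o`. -/
lemma cycle_subset_of_mem {σ : Perm (Fin n)} {o x : Fin n} {A : Finset (Fin n)}
    (hox : ¬ σ.SameCycle o x) (hA : ∀ y ∈ A, σ y ∈ insert o A) {y z : Fin n}
    (hy : y ∈ A) (hxy : σ.SameCycle x y) (hxz : σ.SameCycle x z) : z ∈ A := by
  obtain ⟨i, -, -, rfl⟩ := (hxy.symm.trans hxz).exists_pow_eq''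
  clear hxz
  induction i with
  | zero => simpa using hy
  | succ k ih =>
    rw [pow_succ', Perm.mul_apply]
    rcases Finset.mem_insert.1 (hA _ ih) with h | h
    · exfalso
      apply hox
      rw [← h, ← Perm.mul_apply, ← pow_succ']
      exact ((sameCycle_pow_right (n := k + 1)).2 hxy).symm
    · exact h

/-- An elementary substitute for the orthogonality of hook characters. If `σ = c * d` contributes to
the hook of `A`, then `σ` maps `A` into `A ∪ {o}`, so a cycle `K` avoiding `o` lies inside `A` or
outside it. Moving `K` across is a sign-reversing involution. -/
lemma sum_hookElt_coeff_eq_zero (o : Fin n) {σ : Perm (Fin n)} (hσ : numCycles σ ≠ 1) :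
    ∑ A ∈ (Finset.univ.erase o).powerset, (-1 : ℂ) ^ A.card * (hookElt o A).coeff σ = 0 := by
  classical
  obtain ⟨x, hox⟩ := exists_not_sameCycle o hσ
  set K := cycleSet σ x with hK
  set κ := σ.cycleOf x with hκ
  have hsgn := sign_cycleOf_eq σ x
  rw [← hK, ← hκ] at hsgn
  have hsgn' : ((sign κ⁻¹ : ℤ) : ℂ) = -(-1) ^ K.card := by rw [sign_inv, hsgn]
  have hoK : o ∉ K := fun h => hox (mem_cycleSet.1 h).symm
  have hκK : ∀ y ∈ K, κ y = σ y := fun y hy => (mem_cycleSet.1 hy).cycleOf_apply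
  have hκK' : ∀ y, y ∉ K → κ y = y := fun y hy =>
    cycleOf_apply_of_not_sameCycle fun h => hy (mem_cycleSet.2 h)
  have hκi : ∀ y, y ∉ K → κ⁻¹ y = y := fun y hy => by rw [inv_eq_iff_eq, hκK' y hy]
  have hσK : ∀ y ∈ K, σ y ∈ K := fun y hy =>
    mem_cycleSet.2 ((mem_cycleSet.1 hy).apply_right)
  have hσKi : ∀ y ∈ K, σ⁻¹ y ∈ K := fun y hy =>
    mem_cycleSet.2 ((mem_cycleSet.1 hy).trans ⟨-1, by simp⟩)
  have hκKi : ∀ y ∈ K, κ⁻¹ y = σ⁻¹ y := fun y hy => by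
    rw [inv_eq_iff_eq, hκK _ (hσKi y hy)]; simp
  let T : Finset (Finset (Fin n) × Perm (Fin n) × Perm (Fin n)) :=
    Finset.univ.filter fun t => o ∉ t.1 ∧ t.2.1 ∈ permsOn (insert o t.1) ∧
      t.2.2 ∈ permsOn t.1ᶜ ∧ t.2.1 * t.2.2 = σ
  have hT : ∑ A ∈ (Finset.univ.erase o).powerset, (-1 : ℂ) ^ A.card * (hookElt o A).coeff σ =
      ∑ t ∈ T, (-1 : ℂ) ^ t.1.card * ((sign t.2.1 : ℤ) : ℂ) := by
    have h1 : (Finset.univ.erase o).powerset =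
        Finset.univ.filter fun A : Finset (Fin n) => o ∉ A := by
      ext A
      simp only [Finset.mem_powerset, Finset.mem_filter, Finset.mem_univ, true_and]
      refine ⟨fun h ho => by simpa using h ho, fun h y hy => ?_⟩
      exact Finset.mem_erase.2 ⟨fun e => h (e ▸ hy), Finset.mem_univ _⟩
    rw [h1, Finset.sum_filter, Finset.sum_filter, Fintype.sum_prod_type]
    refine Finset.sum_congr rfl fun A _ => ?_
    by_cases ho : o ∈ A
    · simp [ho]
    · simp only [ho, not_false_eq_true, if_true, true_and]
      rw [coeff_hookElt, Finset.mul_sum, Fintype.sum_prod_type, ← Finset.sum_filter_add_sum_filter_not Finset.univ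
        (fun c => c ∈ permsOn (insert o A))]
      rw [Finset.filter_mem_eq_inter, Finset.univ_inter, Finset.sum_eq_zero (s :=
        Finset.univ.filter fun c => ¬ c ∈ permsOn (insert o A)), add_zero]
      · refine Finset.sum_congr rfl fun c hc => ?_
        rw [Finset.mul_sum, ← Finset.sum_filter_add_sum_filter_not Finset.univ
          (fun d => d ∈ permsOn Aᶜ), Finset.filter_mem_eq_inter, Finset.univ_inter,
          Finset.sum_eq_zero (s := Finset.univ.filter fun d => ¬ d ∈ permsOn Aᶜ), add_zero]
        · refine Finset.sum_congr rfl fun d hd => ?_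
          simp [hc, hd]
        · intro d hd
          rw [Finset.mem_filter] at hd
          simp [hd.2]
      · intro c hc
        rw [Finset.mem_filter] at hc
        simp [hc.2]
  rw [hT]
  have hmemT : ∀ t, t ∈ T ↔ o ∉ t.1 ∧ t.2.1 ∈ permsOn (insert o t.1) ∧
      t.2.2 ∈ permsOn t.1ᶜ ∧ t.2.1 * t.2.2 = σ := fun t => by simp [T]
  have hstab : ∀ t ∈ T, ∀ y ∈ t.1, σ y ∈ insert o t.1 := by
    intro t ht y hy
    obtain ⟨-, hc, hd, rfl⟩ := (hmemT t).1 ht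
    rw [Perm.mul_apply, mem_permsOn.1 hd y (by simpa using hy)]
    exact permsOn_apply_mem hc (Finset.mem_insert_of_mem hy)
  have hKsub : ∀ t ∈ T, x ∈ t.1 → K ⊆ t.1 := fun t ht hx z hz =>
    cycle_subset_of_mem hox (hstab t ht) hx (SameCycle.refl _ _) (mem_cycleSet.1 hz)
  have hKdis : ∀ t ∈ T, x ∉ t.1 → Disjoint t.1 K := by
    intro t ht hx
    rw [Finset.disjoint_left]
    intro z hz hzK
    exact hx (cycle_subset_of_mem hox (hstab t ht) hz (mem_cycleSet.1 hzK) (SameCycle.refl _ _))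
  have hxK : x ∈ K := mem_cycleSet.2 (SameCycle.refl _ _)
  -- The factor `κ` passes between `c` and `d` while `K` passes between column and row. Since `κ`
  -- has sign `-(-1) ^ K.card`, the weight `(-1) ^ A.card * sign c` is negated.
  let g : Finset (Fin n) × Perm (Fin n) × Perm (Fin n) →
      Finset (Fin n) × Perm (Fin n) × Perm (Fin n) := fun t =>
    if x ∈ t.1 then (t.1 \ K, t.2.1 * κ⁻¹, κ * t.2.2) else (t.1 ∪ K, t.2.1 * κ, κ⁻¹ * t.2.2)
  refine Finset.sum_involution (fun t _ => g t) ?_ ?_ ?_ ?_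
  · rintro ⟨A, c, d⟩ ht
    by_cases hx : x ∈ A
    · have hKA : K ⊆ A := hKsub _ ht hx
      simp only [g, hx, if_true]
      rw [Perm.sign_mul, Units.val_mul, Int.cast_mul, hsgn', ← Finset.card_sdiff_add_card_eq_card hKA,
        pow_add]
      have : ((-1 : ℂ) ^ K.card) * (-1) ^ K.card = 1 := by
        rw [← mul_pow]; simp
      linear_combination (0 : ℂ) * this
    · have hKA : Disjoint A K := hKdis _ ht hx
      simp only [g, hx, if_false]
      rw [Perm.sign_mul, Units.val_mul, Int.cast_mul, hsgn, Finset.card_union_of_disjoint hKA,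
        pow_add]
      have : ((-1 : ℂ) ^ K.card) * (-1) ^ K.card = 1 := by
        rw [← mul_pow]; simp
      linear_combination (-(-1) ^ A.card * ((sign c : ℤ) : ℂ)) * this
  · rintro ⟨A, c, d⟩ ht - he
    have h1 := congrArg Prod.fst he
    by_cases hx : x ∈ A
    · simp only [g, hx, if_true] at h1
      have : x ∈ A \ K := h1.symm ▸ hx
      exact (Finset.mem_sdiff.1 this).2 hxK
    · simp only [g, hx, if_false] at h1
      exact hx (h1 ▸ Finset.mem_union_right _ hxK)
  · rintro ⟨A, c, d⟩ ht
    obtain ⟨ho, hc, hd, hcd⟩ := (hmemT _).1 ht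
    simp only at ho hc hd hcd
    rw [mem_permsOn] at hc hd
    by_cases hx : x ∈ A
    · have hKA : K ⊆ A := hKsub _ ht hx
      simp only [g, hx, if_true]
      rw [hmemT]
      refine ⟨fun h => ho (Finset.mem_sdiff.1 h).1, ?_, ?_, by simp [← hcd, mul_assoc]⟩
      · rw [mem_permsOn]
        intro y hy
        simp only [Finset.mem_insert, Finset.mem_sdiff, not_or, not_and, not_not] at hy
        rw [Perm.mul_apply]
        by_cases hyK : y ∈ K
        · rw [hκKi y hyK]
          have h2 : d (σ⁻¹ y) = σ⁻¹ y := hd _ (by simpa using hKA (hσKi y hyK))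
          calc c (σ⁻¹ y) = (c * d) (σ⁻¹ y) := by rw [Perm.mul_apply, h2]
            _ = y := by rw [hcd]; simp
        · rw [hκi y hyK]
          exact hc y (by simp only [Finset.mem_insert, not_or]; exact ⟨hy.1, fun h => hyK (hy.2 h)⟩)
      · rw [mem_permsOn]
        intro y hy
        simp only [Finset.mem_compl, Finset.mem_sdiff, not_not] at hy
        rw [Perm.mul_apply, hd y (by simpa using hy.1), hκK' y hy.2]
    · have hKA : Disjoint A K := hKdis _ ht hx
      simp only [g, hx, if_false]
      rw [hmemT]
      refine ⟨fun h => (Finset.mem_union.1 h).elim ho hoK, ?_, ?_, by simp [← hcd, mul_assoc]⟩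
      · rw [mem_permsOn]
        intro y hy
        simp only [Finset.mem_insert, Finset.mem_union, not_or] at hy
        rw [Perm.mul_apply, hκK' y hy.2.2, hc y (by simp [hy.1, hy.2.1])]
      · rw [mem_permsOn]
        intro y hy
        simp only [Finset.mem_compl, Finset.mem_union, not_not] at hy
        rw [Perm.mul_apply]
        rcases hy with hy | hy
        · rw [hd y (by simpa using hy), hκi y (Finset.disjoint_left.1 hKA hy)]
        · have h2 : σ y ∉ insert o A := by
            rw [Finset.mem_insert, not_or]
            exact ⟨fun h => hoK (h ▸ hσK y hy), Finset.disjoint_right.1 hKA (hσK y hy)⟩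
          have h3 : d y = σ y := by
            apply c.injective
            rw [hc _ h2, ← hcd, Perm.mul_apply]
          rw [h3, inv_eq_iff_eq, hκK y hy]
  · rintro ⟨A, c, d⟩ ht
    by_cases hx : x ∈ A
    · have hKA : K ⊆ A := hKsub _ ht hx
      simp [g, hx, hxK, Finset.sdiff_union_of_subset hKA]
    · have hKA : Disjoint A K := hKdis _ ht hx
      simp [g, hx, hxK, Finset.union_sdiff_cancel_right hKA]

lemma coeff_mul_eq_sum (u v : SymAlg n) (g : Perm (Fin n)) :
    (u * v).coeff g = ∑ h, u.coeff h * v.coeff (h⁻¹ * g) := by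
  rw [MonoidAlgebra.coeff_mul_apply_left, Finsupp.sum_fintype]
  intro i; simp

lemma hookScalar_eq_sum (o : Fin n) (A : Finset (Fin n)) (u : SymAlg n) :
    hookScalar o A u = ∑ g, u.coeff g⁻¹ * (hookElt o A).coeff g := by
  rw [hookScalar, coeff_mul_eq_sum]
  refine Fintype.sum_equiv (Equiv.inv _) _ _ fun g => ?_
  simp

/-- For `A = ∅` the hook is a single row and the scalar of a central element is the sum of its
coefficients. -/
lemma card_cycleClass_one (hn : 0 < n) : (cycleClass n 1).card = (n - 1).factorial := by
  have o : Fin n := ⟨0, hn⟩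
  have h1 := hookScalar_longCycleSum (n := n) (o := o) (A := ∅) (by simp)
  rw [hookScalar, coeff_one_mul_hookElt, insert_empty_eq, permsOn_singleton,
    Finset.sum_singleton] at h1
  have h2 : permsOn (∅ : Finset (Fin n))ᶜ = Finset.univ := by
    ext p; simp [mem_permsOn]
  rw [h2] at h1
  simp only [one_mul, longCycleSum, coeff_classElt, numCycles_inv, Finset.card_empty,
    Nat.factorial_zero, Perm.sign_one, Units.val_one,
    Int.cast_one, pow_zero, Nat.sub_zero, Nat.cast_one] at h1
  rw [Finset.sum_boole] at h1
  exact_mod_cast h1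

/-- By the vanishing lemma, both sides depend only on the constant value of `u` on `n`-cycles. Hence
it is enough to compare them at `u = longCycleSum n`, where each equals `n * (n - 1)!`. -/
lemma alternating_sum_hookScalar (o : Fin n) {u : SymAlg n}
    (hu : u ∈ Subalgebra.center ℂ (SymAlg n)) :
    ∑ A ∈ (Finset.univ.erase o).powerset, (-1 : ℂ) ^ A.card * hookScalar o A u =
      n * (longCycleSum n * u).coeff 1 := by
  classical
  have hlong : ∀ v : SymAlg n, (longCycleSum n * v).coeff 1 =
      ∑ g, if numCycles g = 1 then v.coeff g⁻¹ else 0 := by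
    intro v
    rw [coeff_mul_eq_sum]
    refine Finset.sum_congr rfl fun g _ => ?_
    simp [longCycleSum]
  have hZ : ∀ g : Perm (Fin n), (longCycleSum n).coeff g⁻¹ =
      if numCycles g = 1 then 1 else 0 := fun g => by
    rw [longCycleSum, coeff_classElt, numCycles_inv]
  have hLHS : ∀ v : SymAlg n,
      ∑ A ∈ (Finset.univ.erase o).powerset, (-1 : ℂ) ^ A.card * hookScalar o A v =
      ∑ g, v.coeff g⁻¹ * ∑ A ∈ (Finset.univ.erase o).powerset,
        (-1 : ℂ) ^ A.card * (hookElt o A).coeff g := by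
    intro v
    simp_rw [hookScalar_eq_sum, Finset.mul_sum]
    rw [Finset.sum_comm]
    refine Finset.sum_congr rfl fun g _ => Finset.sum_congr rfl fun A _ => ?_
    ring
  have hn : 0 < n := Fin.pos o
  have hmem : ∀ A ∈ (Finset.univ.erase o).powerset, o ∉ A := fun A hA h => by
    simpa using Finset.mem_powerset.1 hA h
  have hLZ : ∑ A ∈ (Finset.univ.erase o).powerset,
      (-1 : ℂ) ^ A.card * hookScalar o A (longCycleSum n) = n * ((n - 1).factorial : ℂ) := by
    have h1 : ∀ A ∈ (Finset.univ.erase o).powerset,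
        (-1 : ℂ) ^ A.card * hookScalar o A (longCycleSum n) =
        (fun r => ((r.factorial * (n - 1 - r).factorial : ℕ) : ℂ)) A.card := by
      intro A hA
      rw [hookScalar_longCycleSum (hmem A hA), ← mul_assoc, ← mul_pow]
      simp
    rw [Finset.sum_congr rfl h1, Finset.sum_powerset_apply_card
      (fun r => ((r.factorial * (n - 1 - r).factorial : ℕ) : ℂ)),
      Finset.card_erase_of_mem (Finset.mem_univ o), Finset.card_univ, Fintype.card_fin,
      Nat.sub_add_cancel hn]
    have h2 : ∀ r ∈ Finset.range n,
        (n - 1).choose r • ((r.factorial * (n - 1 - r).factorial : ℕ) : ℂ) =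
        ((n - 1).factorial : ℂ) := by
      intro r hr
      rw [nsmul_eq_mul, ← Nat.cast_mul, ← mul_assoc,
        Nat.choose_mul_factorial_mul_factorial (by have := Finset.mem_range.1 hr; omega)]
    rw [Finset.sum_congr rfl h2, Finset.sum_const, Finset.card_range, nsmul_eq_mul]
  have hRZ : (longCycleSum n * longCycleSum n).coeff 1 = ((n - 1).factorial : ℂ) := by
    rw [hlong, ← card_cycleClass_one hn, cycleClass, ← Finset.sum_boole]
    refine Finset.sum_congr rfl fun g _ => ?_
    rw [hZ]
    split_ifs <;> rfl
  -- No `n`-cycle has to be exhibited: if there were none, both sides would be zero.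
  by_cases hex : ∃ σ₀ : Perm (Fin n), numCycles σ₀ = 1
  · obtain ⟨σ₀, hσ₀⟩ := hex
    have hconst : ∀ g : Perm (Fin n), numCycles g = 1 → u.coeff g⁻¹ = u.coeff σ₀⁻¹ := by
      intro g hg
      obtain ⟨c, hc⟩ := isConj_iff.1 (isConj_of_numCycles_eq_one hσ₀ hg)
      rw [← hc, mul_inv_rev, mem_center_iff_coeff.1 hu]
      simp
    have h1 : ∑ A ∈ (Finset.univ.erase o).powerset, (-1 : ℂ) ^ A.card * hookScalar o A u =
        u.coeff σ₀⁻¹ * ∑ A ∈ (Finset.univ.erase o).powerset,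
          (-1 : ℂ) ^ A.card * hookScalar o A (longCycleSum n) := by
      rw [hLHS, hLHS, Finset.mul_sum]
      refine Finset.sum_congr rfl fun g _ => ?_
      by_cases hg : numCycles g = 1
      · rw [hconst g hg, hZ, if_pos hg, one_mul]
      · rw [sum_hookElt_coeff_eq_zero o hg, mul_zero, mul_zero, mul_zero]
    have h2 : (longCycleSum n * u).coeff 1 =
        u.coeff σ₀⁻¹ * (longCycleSum n * longCycleSum n).coeff 1 := by
      rw [hlong, hlong, Finset.mul_sum]
      refine Finset.sum_congr rfl fun g _ => ?_
      by_cases hg : numCycles g = 1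
      · rw [if_pos hg, if_pos hg, hconst g hg, hZ, if_pos hg, mul_one]
      · rw [if_neg hg, if_neg hg, mul_zero]
    rw [h1, h2, hLZ, hRZ]
    ring
  · push Not at hex
    rw [hLHS, hlong, Finset.sum_eq_zero, Finset.sum_eq_zero, mul_zero]
    · intro g _; rw [if_neg (hex g)]
    · intro g _; rw [sum_hookElt_coeff_eq_zero o (hex g), mul_zero]

/-- The sum of a function of the number of cycles over a translate of the set of `n`-cycles. -/
def longTranslate (f : ℕ → ℂ) (π : Perm (Fin n)) : ℂ :=
  ∑ σ ∈ cycleClass n 1, f (numCycles (σ⁻¹ * π))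

lemma coeff_longCycleSum_mul_powElt (x : ℕ) (π : Perm (Fin n)) :
    (longCycleSum n * powElt n x).coeff π = longTranslate (fun k => (x : ℂ) ^ k) π := by
  rw [coeff_mul_eq_sum, longTranslate, cycleClass, Finset.sum_filter]
  refine Finset.sum_congr rfl fun g _ => ?_
  simp [longCycleSum, powElt]

lemma longTranslate_inv (f : ℕ → ℂ) (π : Perm (Fin n)) :
    longTranslate f π⁻¹ = longTranslate f π := by
  refine Finset.sum_nbij' (fun σ => σ⁻¹) (fun σ => σ⁻¹) ?_ ?_ ?_ ?_ ?_
  · intro σ hσ; simpa [cycleClass, numCycles_inv] using hσ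
  · intro σ hσ; simpa [cycleClass, numCycles_inv] using hσ
  · intro σ _; simp
  · intro σ _; simp
  · intro σ _
    rw [← numCycles_inv, mul_inv_rev, inv_inv, inv_inv, numCycles_mul_comm]

/-- The pairing of two powers of a variable under convolution with two random `n`-cycles. -/
lemma sum_longTranslate_pow (hn : 0 < n) (x y : ℕ) :
    ∑ π : Perm (Fin n), longTranslate (fun k => (x : ℂ) ^ k) π *
        longTranslate (fun k => (y : ℂ) ^ k) π =
      n.factorial * ((n - 1).factorial : ℂ) ^ 2 *
        ∑ r ∈ Finset.range n, ((x + n - 1 - r).choose n : ℂ) * ((y + n - 1 - r).choose n : ℂ) := by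
  have o : Fin n := ⟨0, hn⟩
  have hZ := longCycleSum_mem_center (n := n)
  have hx := powElt_mem_center (n := n) x
  have hy := powElt_mem_center (n := n) y
  have hmem : ∀ A ∈ (Finset.univ.erase o).powerset, o ∉ A := fun A hA h => by
    simpa using Finset.mem_powerset.1 hA h
  -- As `longTranslate` is invariant under inversion, the pairing is the coefficient of `1` in a
  -- convolution.
  have h1 : ∑ π : Perm (Fin n), longTranslate (fun k => (x : ℂ) ^ k) π *
        longTranslate (fun k => (y : ℂ) ^ k) π =
      (longCycleSum n * (longCycleSum n * (powElt n x * powElt n y))).coeff 1 := by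
    have h2 : longCycleSum n * (longCycleSum n * (powElt n x * powElt n y)) =
        (longCycleSum n * powElt n x) * (longCycleSum n * powElt n y) := by
      rw [← mul_assoc (longCycleSum n) (powElt n x) (powElt n y),
        Subalgebra.mem_center_iff.1 hx (longCycleSum n)]
      simp only [mul_assoc]
      rw [← mul_assoc (longCycleSum n) (powElt n x), Subalgebra.mem_center_iff.1 hx, mul_assoc]
    rw [h2, coeff_mul_eq_sum]
    refine Finset.sum_congr rfl fun π _ => ?_
    rw [mul_one, coeff_longCycleSum_mul_powElt, coeff_longCycleSum_mul_powElt, longTranslate_inv]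
  have hn0 : (n : ℂ) ≠ 0 := by exact_mod_cast hn.ne'
  apply mul_left_cancel₀ hn0
  rw [h1, ← alternating_sum_hookScalar o (mul_mem hZ (mul_mem hx hy))]
  have h3 : ∀ A ∈ (Finset.univ.erase o).powerset, (-1 : ℂ) ^ A.card *
      hookScalar o A (longCycleSum n * (powElt n x * powElt n y)) =
      (fun r => ((r.factorial * (n - 1 - r).factorial : ℕ) : ℂ) * ((n.factorial : ℂ) ^ 2 *
        (((x + n - 1 - r).choose n : ℂ) * ((y + n - 1 - r).choose n : ℂ)))) A.card := by
    intro A hA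
    have ho := hmem A hA
    rw [hookScalar_mul ho hZ (mul_mem hx hy), hookScalar_mul ho hx hy,
      hookScalar_longCycleSum ho, hookScalar_powElt ho, hookScalar_powElt ho]
    have h4 : ((-1 : ℂ) ^ A.card) * (-1) ^ A.card = 1 := by
      rw [← mul_pow]; simp
    push_cast
    linear_combination (A.card.factorial * (n - 1 - A.card).factorial *
      (n.factorial * ((x + n - 1 - A.card).choose n : ℂ)) *
      (n.factorial * ((y + n - 1 - A.card).choose n : ℂ))) * h4
  rw [Finset.sum_congr rfl h3, Finset.sum_powerset_apply_card (fun r =>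
      ((r.factorial * (n - 1 - r).factorial : ℕ) : ℂ) * ((n.factorial : ℂ) ^ 2 *
        (((x + n - 1 - r).choose n : ℂ) * ((y + n - 1 - r).choose n : ℂ)))),
    Finset.card_erase_of_mem (Finset.mem_univ o), Finset.card_univ, Fintype.card_fin,
    Nat.sub_add_cancel hn, Finset.mul_sum, Finset.mul_sum]
  refine Finset.sum_congr rfl fun r hr => ?_
  rw [nsmul_eq_mul, ← mul_assoc, ← Nat.cast_mul, ← mul_assoc ((n - 1).choose r),
    Nat.choose_mul_factorial_mul_factorial (by have := Finset.mem_range.1 hr; omega)]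
  have h4 : (n.factorial : ℂ) = n * ((n - 1).factorial : ℂ) := by
    rw [← Nat.cast_mul, Nat.mul_factorial_pred hn.ne']
  rw [h4]
  ring

end Vanishing

end FoulkesCarries
end

noncomputable section
namespace FoulkesCarries

open Equiv Equiv.Perm

/-! ### Binomial identities and the carries matrix -/

section Binomial

open PowerSeries in
lemma coeff_one_sub_X_pow_mul (n b m : ℕ) :
    coeff m (((1 : ℂ⟦X⟧) - X ^ b) ^ (n + 1) * PowerSeries.mk fun k => ((n + k).choose n : ℂ)) =
      ∑ k ∈ Finset.range (n + 2), if b * k ≤ m then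
        (-1) ^ k * ((n + 1).choose k : ℂ) * ((n + (m - b * k)).choose n : ℂ) else 0 := by
  have h1 : ((1 : ℂ⟦X⟧) - X ^ b) ^ (n + 1) =
      ∑ k ∈ Finset.range (n + 2), C ((-1) ^ k * ((n + 1).choose k : ℂ)) * X ^ (b * k) := by
    rw [sub_eq_neg_add, add_pow]
    refine Finset.sum_congr rfl fun k _ => ?_
    rw [neg_pow, ← pow_mul, one_pow, mul_one, map_mul, map_pow, map_neg, map_one, map_natCast]
    ring
  rw [h1, Finset.sum_mul, map_sum]
  refine Finset.sum_congr rfl fun k _ => ?_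
  rw [mul_assoc, coeff_C_mul, coeff_X_pow_mul', coeff_mk]
  split_ifs
  · rfl
  · rw [mul_zero]

/-- Inverts the triangular matrix of the binomials `(x + n - 1 - r).choose n`, `1 ≤ x ≤ n`: the sum
is the coefficient of `X ^ (i - r)` in `(1 - X) ^ (n + 1) * (1 - X) ^ (-(n + 1))`. -/
lemma sum_choose_mul_choose_eq_ite {n i r : ℕ} (hi : i < n) (hr : r < n) :
    ∑ k ∈ Finset.range (i + 1), (-1 : ℂ) ^ k * ((n + 1).choose k : ℂ) *
      ((i + 1 - k + n - 1 - r).choose n : ℂ) = if i = r then 1 else 0 := by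
  by_cases hri : r ≤ i
  · have h := coeff_one_sub_X_pow_mul n 1 (i - r)
    have h1 : ((1 : PowerSeries ℂ) - PowerSeries.X ^ 1) ^ (n + 1) *
        (PowerSeries.mk fun k => ((n + k).choose n : ℂ)) = 1 := by
      rw [pow_one, mul_comm]
      exact PowerSeries.mk_add_choose_mul_one_sub_pow_eq_one ℂ n
    rw [h1, PowerSeries.coeff_one] at h
    have h2 : (if i - r = 0 then (1 : ℂ) else 0) = if i = r then 1 else 0 := by
      congr 1
      simp only [eq_iff_iff]
      omega
    rw [← h2, h]
    have hsub : Finset.range (i + 1) ⊆ Finset.range (n + 2) :=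
      Finset.range_subset_range.2 (by omega)
    rw [← Finset.sum_subset hsub]
    · refine Finset.sum_congr rfl fun k hk => ?_
      have hk' := Finset.mem_range.1 hk
      split_ifs with hle
      · have e : i + 1 - k + n - 1 - r = n + (i - r - 1 * k) := by omega
        rw [e]
      · have e : (i + 1 - k + n - 1 - r).choose n = 0 := Nat.choose_eq_zero_of_lt (by omega)
        rw [e, Nat.cast_zero, mul_zero]
    · intro k _ hk
      rw [Finset.mem_range] at hk
      rw [if_neg (by omega)]
  · rw [if_neg (by omega)]
    refine Finset.sum_eq_zero fun k hk => ?_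
    have hk' := Finset.mem_range.1 hk
    have e : (i + 1 - k + n - 1 - r).choose n = 0 := Nat.choose_eq_zero_of_lt (by omega)
    rw [e, Nat.cast_zero, mul_zero]

open PowerSeries in
lemma coeff_geom_pow (N b m : ℕ) :
    coeff m ((∑ a : Fin b, (X : ℂ⟦X⟧) ^ (a : ℕ)) ^ N) =
      ∑ e : Fin N → Fin b, if ∑ k, (e k : ℕ) = m then 1 else 0 := by
  have h1 : (∑ a : Fin b, (X : ℂ⟦X⟧) ^ (a : ℕ)) ^ N =
      ∑ e : Fin N → Fin b, X ^ (∑ k, (e k : ℕ)) := by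
    have h2 := Finset.prod_univ_sum (fun _ : Fin N => (Finset.univ : Finset (Fin b)))
      (fun _ a => (X : ℂ⟦X⟧) ^ (a : ℕ))
    rw [Finset.prod_const, Finset.card_univ, Fintype.card_fin, Fintype.piFinset_univ] at h2
    rw [h2]
    exact Finset.sum_congr rfl fun e _ => Finset.prod_pow_eq_pow_sum _ _ _
  rw [h1, map_sum]
  refine Finset.sum_congr rfl fun e _ => ?_
  rw [coeff_X_pow]
  simp only [eq_comm]

open PowerSeries in
lemma geom_pow_eq (n b : ℕ) : (∑ a : Fin b, (X : ℂ⟦X⟧) ^ (a : ℕ)) ^ (n + 1) =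
    ((1 : ℂ⟦X⟧) - X ^ b) ^ (n + 1) * PowerSeries.mk fun k => ((n + k).choose n : ℂ) := by
  have h1 : (∑ a : Fin b, (X : ℂ⟦X⟧) ^ (a : ℕ)) * (1 - X) = 1 - X ^ b := by
    rw [Fin.sum_univ_eq_sum_range (fun a => (X : ℂ⟦X⟧) ^ a), geom_sum_mul_neg]
  rw [← h1, mul_pow, mul_assoc, mul_comm ((1 - X) ^ (n + 1)),
    PowerSeries.mk_add_choose_mul_one_sub_pow_eq_one ℂ n, mul_one]

/-- Holte's formula. The digit columns are counted by a coefficient of `(1 + X + ⋯ + X ^ (b - 1)) ^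
(n + 1)`, with one factor for each digit and one for a slack digit. -/
lemma carriesMatrix_eq {n b : ℕ} (hb : 2 ≤ b) (i j : Fin n) :
    (carriesMatrix n b i j : ℂ) = ((b : ℂ) ^ n)⁻¹ * ∑ k ∈ Finset.range (j + 1), (-1 : ℂ) ^ k *
      ((n + 1).choose k : ℂ) * ((b * (j + 1 - k) + n - 1 - i).choose n : ℂ) := by
  have hi := i.isLt
  have hj := j.isLt
  have hcount : ((Finset.univ.filter fun d : Fin n → Fin b => nextCarry n b i d = j).card : ℂ) =
      ∑ k ∈ Finset.range (j + 1), (-1 : ℂ) ^ k *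
      ((n + 1).choose k : ℂ) * ((b * (j + 1 - k) + n - 1 - i).choose n : ℂ) := by
    have hdiv : ∀ d : Fin n → Fin b, nextCarry n b i d = j ↔
        b * j ≤ i + ∑ k, (d k : ℕ) ∧ (i : ℕ) + ∑ k, (d k : ℕ) < b * (j + 1) := by
      intro d
      rw [Fin.ext_iff, nextCarry, Nat.div_eq_iff (by omega)]
      rw [mul_add, mul_comm b]
      omega
    have hmul : ∀ k, k ≤ (j : ℕ) → b * (j + 1 - k) + b * k = b * (j + 1) := fun k hk => by
      rw [← mul_add]; congr 1; omega
    -- Guards the truncated subtraction in the exponent `b * (j + 1) - 1 - i`. Otherwise the carry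
    -- `j` is unreachable and every binomial vanishes.
    by_cases hm : (i : ℕ) < b * (j + 1)
    -- The new carry is `j` exactly when some slack digit in `0, …, b - 1` raises `i + ∑ d` to `b *
    -- (j + 1) - 1`, and that digit is unique.
    · have h1 : ((Finset.univ.filter fun d : Fin n → Fin b => nextCarry n b i d = j).card : ℂ) =
          ∑ e : Fin (n + 1) → Fin b, if ∑ k, (e k : ℕ) = b * (j + 1) - 1 - i then 1 else 0 := by
        rw [← Finset.sum_boole, ← (Fin.consEquiv fun _ => Fin b).sum_comp,
          Fintype.sum_prod_type, Finset.sum_comm]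
        refine Finset.sum_congr rfl fun d _ => ?_
        simp only [Fin.consEquiv_apply, Fin.sum_univ_succ, Fin.cons_zero, Fin.cons_succ]
        split_ifs with h
        · rw [hdiv] at h
          have hlt : b * (j + 1) - 1 - i - ∑ k, (d k : ℕ) < b := by
            rw [mul_add] at h ⊢; omega
          rw [Finset.sum_eq_single ⟨b * (j + 1) - 1 - i - ∑ k, (d k : ℕ), hlt⟩]
          · rw [if_pos (by simp only; omega)]
          · intro a _ ha
            rw [if_neg]
            intro h2
            exact ha (Fin.ext (by simp only; omega))
          · simp
        · rw [Finset.sum_eq_zero]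
          intro a _
          rw [if_neg]
          intro h2
          apply h
          rw [hdiv]
          have := a.isLt
          rw [mul_add] at h2 hm ⊢
          omega
      rw [h1, ← coeff_geom_pow, geom_pow_eq, coeff_one_sub_X_pow_mul]
      have hsub : Finset.range (j + 1) ⊆ Finset.range (n + 2) :=
        Finset.range_subset_range.2 (by omega)
      rw [← Finset.sum_subset hsub]
      · refine Finset.sum_congr rfl fun k hk => ?_
        have hk' := Finset.mem_range.1 hk
        have := hmul k (by omega)
        split_ifs with hle
        · have e : n + (b * (j + 1) - 1 - i - b * k) = b * (j + 1 - k) + n - 1 - i := by omega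
          rw [e]
        · have e : (b * (j + 1 - k) + n - 1 - i).choose n = 0 :=
            Nat.choose_eq_zero_of_lt (by omega)
          rw [e, Nat.cast_zero, mul_zero]
      · intro k _ hk
        rw [Finset.mem_range, not_lt] at hk
        have : b * (j + 1) ≤ b * k := Nat.mul_le_mul_left _ hk
        rw [if_neg (by omega)]
    · rw [Finset.filter_false_of_mem, Finset.card_empty, Nat.cast_zero]
      · symm
        refine Finset.sum_eq_zero fun k hk => ?_
        have hk' := Finset.mem_range.1 hk
        have := hmul k (by omega)
        have e : (b * (j + 1 - k) + n - 1 - i).choose n = 0 :=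
          Nat.choose_eq_zero_of_lt (by omega)
        rw [e, Nat.cast_zero, mul_zero]
      · intro d _ h
        rw [hdiv] at h
        omega
  rw [← hcount, carriesMatrix]
  simp only [Fintype.card_pi, Fintype.card_fin, Finset.prod_const, Finset.card_univ]
  push_cast
  rw [div_eq_inv_mul]

end Binomial

/-! ### The bracket as a convolution, and its value on Foulkes functions -/

section Bracket

variable {n : ℕ}

lemma classValue_numCycles (θ : CFlen n) (π : Perm (Fin n)) :
    classValue θ (numCycles π) = θ.1 π := by
  have h : (cycleClass n (numCycles π)).Nonempty := ⟨π, by simp [cycleClass]⟩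
  rw [classValue, dif_pos h]
  refine θ.2 _ _ ?_
  exact (Finset.mem_filter.1 h.choose_spec).2

/-- Write the intersection size as a sum over `π` of two indicators, one involving only `σ` and one
only `τ`. The average over `σ` and `τ` then factors for each `π`. -/
lemma bracket_eq (hn : 0 < n) (θ ψ : CFlen n) (f h : ℕ → ℂ) (hf : ∀ π, θ.1 π = f (numCycles π))
    (hh : ∀ π, (starRingEnd ℂ) (ψ.1 π) = h (numCycles π)) :
    bracket θ ψ = (n.factorial * ((n - 1).factorial : ℂ) ^ 2)⁻¹ *
      ∑ π : Perm (Fin n), longTranslate f π * longTranslate h π := by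
  classical
  let U : ℕ → Perm (Fin n) → ℂ := fun k π =>
    ∑ σ ∈ cycleClass n 1, if numCycles (σ⁻¹ * π) = k then 1 else 0
  have hcard : ∀ (k l : ℕ) (σ τ : Perm (Fin n)),
      ((((cycleClass n k).image fun x => σ * x) ∩
        ((cycleClass n l).image fun y => τ * y)).card : ℂ) =
      ∑ π : Perm (Fin n), (if numCycles (σ⁻¹ * π) = k then 1 else 0) *
        (if numCycles (τ⁻¹ * π) = l then 1 else 0) := by
    intro k l σ τ
    have hset : ((cycleClass n k).image fun x => σ * x) ∩
        ((cycleClass n l).image fun y => τ * y) =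
        Finset.univ.filter fun π => numCycles (σ⁻¹ * π) = k ∧ numCycles (τ⁻¹ * π) = l := by
      have himg : ∀ (m : ℕ) (ρ π : Perm (Fin n)), (π ∈ (cycleClass n m).image fun x => ρ * x) ↔
          numCycles (ρ⁻¹ * π) = m := by
        intro m ρ π
        simp only [cycleClass, Finset.mem_image, Finset.mem_filter, Finset.mem_univ, true_and]
        constructor
        · rintro ⟨x, hx, rfl⟩; simpa using hx
        · exact fun h => ⟨ρ⁻¹ * π, h, by simp⟩
      ext π
      rw [Finset.mem_inter, himg, himg, Finset.mem_filter]
      simp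
    rw [hset, ← Finset.sum_boole]
    refine Finset.sum_congr rfl fun π _ => ?_
    by_cases h1 : numCycles (σ⁻¹ * π) = k <;> by_cases h2 : numCycles (τ⁻¹ * π) = l <;>
      simp [h1, h2]
  have hexp : ∀ k l, (expectedCommon n k l : ℂ) =
      (∑ π : Perm (Fin n), U k π * U l π) * (((n - 1).factorial : ℂ) ^ 2)⁻¹ := by
    intro k l
    rw [expectedCommon, card_cycleClass_one hn]
    push_cast
    rw [div_eq_mul_inv]
    congr 1
    simp only [hcard, U, Finset.sum_mul_sum]
    symm
    rw [Finset.sum_comm]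
    refine Finset.sum_congr rfl fun σ _ => ?_
    rw [Finset.sum_comm]
  have hT : ∀ (v g : ℕ → ℂ),
      (∀ π : Perm (Fin n), v (numCycles π) = g (numCycles π)) → ∀ π : Perm (Fin n), ∑ k ∈ Finset.Icc 1 n, v k * U k π = longTranslate g π := by
    intro v g hv π
    simp only [U, Finset.mul_sum, longTranslate]
    rw [Finset.sum_comm]
    refine Finset.sum_congr rfl fun σ _ => ?_
    rw [Finset.sum_eq_single (numCycles (σ⁻¹ * π))]
    · rw [if_pos rfl, mul_one, hv]
    · intro k _ hk
      rw [if_neg hk.symm, mul_zero]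
    · intro hk
      exact absurd (Finset.mem_Icc.2 ⟨numCycles_pos hn _, numCycles_le _⟩) hk
  have h1 : ∀ π, longTranslate f π * longTranslate h π =
      ∑ k ∈ Finset.Icc 1 n, ∑ l ∈ Finset.Icc 1 n,
        classValue θ k * (starRingEnd ℂ) (classValue ψ l) * (U k π * U l π) := by
    intro π
    rw [← hT (classValue θ) f (fun π => by rw [classValue_numCycles, hf]) π,
      ← hT (fun l => (starRingEnd ℂ) (classValue ψ l)) h
        (fun π => by rw [classValue_numCycles, hh]) π, Finset.sum_mul_sum]
    exact Finset.sum_congr rfl fun k _ => Finset.sum_congr rfl fun l _ => by ring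
  rw [bracket, Fintype.card_perm, Fintype.card_fin, mul_inv, one_div, mul_assoc]
  congr 1
  simp only [h1]
  symm
  rw [Finset.sum_comm, Finset.mul_sum]
  refine Finset.sum_congr rfl fun k _ => ?_
  rw [Finset.sum_comm, Finset.mul_sum]
  refine Finset.sum_congr rfl fun l _ => ?_
  rw [hexp, ← Finset.mul_sum]
  ring

/-- The value of the Foulkes character `φ_i` of `S_n` at a permutation with `l` cycles. -/
def foulkesValue (n i l : ℕ) : ℂ :=
  ∑ k ∈ Finset.range (i + 1), (-1 : ℂ) ^ k * ((n + 1).choose k : ℂ) * ((i + 1 - k : ℕ) : ℂ) ^ l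

lemma longTranslate_sum {ι : Type*} (s : Finset ι) (c : ι → ℂ) (g : ι → ℕ → ℂ)
    (π : Perm (Fin n)) :
    longTranslate (fun l => ∑ k ∈ s, c k * g k l) π = ∑ k ∈ s, c k * longTranslate (g k) π := by
  simp only [longTranslate, Finset.mul_sum]
  rw [Finset.sum_comm]

/-- Reduces the theorem to the formula for the values of the Foulkes characters, taken here as the
hypothesis `hv`. -/
lemma carriesMatrix_eq_bracket {b : ℕ} (hb : 2 ≤ b)
    (hv : ∀ (i : Fin n) π, foulkes n i π = foulkesValue n i (numCycles π))
    (hφ : ∀ i : Fin n, foulkes n i ∈ CFlen n) (i j : Fin n) :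
    (carriesMatrix n b i j : ℂ) =
      bracket ⟨foulkes n i, hφ i⟩ (twist b ⟨foulkes n j, hφ j⟩) := by
  have hn : 0 < n := Fin.pos i
  have hb0 : (b : ℂ) ≠ 0 := by
    have : b ≠ 0 := by omega
    exact_mod_cast this
  have htw : ∀ π : Perm (Fin n),
      (starRingEnd ℂ) ((twist b ⟨foulkes n j, hφ j⟩ : CFlen n).1 π) =
      (fun l => ∑ k ∈ Finset.range (j + 1), (((b : ℂ) ^ n)⁻¹ * ((-1 : ℂ) ^ k *
        ((n + 1).choose k : ℂ))) * ((b * (j + 1 - k) : ℕ) : ℂ) ^ l) (numCycles π) := by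
    intro π
    simp only [twist, hv, foulkesValue, map_mul, map_sum, map_pow, map_neg, map_one,
      map_natCast, map_zpow₀, Finset.mul_sum]
    refine Finset.sum_congr rfl fun k _ => ?_
    rw [zpow_sub₀ hb0, zpow_natCast, zpow_natCast, Nat.cast_mul, mul_pow, div_eq_mul_inv]
    ring
  rw [bracket_eq hn _ _ (foulkesValue n i) (fun l => ∑ k ∈ Finset.range (j + 1),
    (((b : ℂ) ^ n)⁻¹ * ((-1 : ℂ) ^ k * ((n + 1).choose k : ℂ))) *
      ((b * (j + 1 - k) : ℕ) : ℂ) ^ l) (hv i) htw, carriesMatrix_eq hb]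
  have h1 : ∀ π : Perm (Fin n), longTranslate (foulkesValue n i) π =
      ∑ k ∈ Finset.range (i + 1), ((-1 : ℂ) ^ k * ((n + 1).choose k : ℂ)) *
        longTranslate (fun l => ((i + 1 - k : ℕ) : ℂ) ^ l) π :=
    fun π => longTranslate_sum _ _ (fun k l => ((i + 1 - k : ℕ) : ℂ) ^ l) π
  have h2 := fun π : Perm (Fin n) => longTranslate_sum (Finset.range (j + 1))
    (fun k => ((b : ℂ) ^ n)⁻¹ * ((-1 : ℂ) ^ k * ((n + 1).choose k : ℂ)))
    (fun k l => ((b * (j + 1 - k) : ℕ) : ℂ) ^ l) π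
  simp only [h1, h2, Finset.sum_mul_sum]
  rw [Finset.sum_comm]
  have h3 : ∀ k ∈ Finset.range ((i : ℕ) + 1), (∑ π : Perm (Fin n),
      ∑ l ∈ Finset.range ((j : ℕ) + 1), (-1 : ℂ) ^ k * ((n + 1).choose k : ℂ) *
        longTranslate (fun l => ((i + 1 - k : ℕ) : ℂ) ^ l) π *
        (((b : ℂ) ^ n)⁻¹ * ((-1 : ℂ) ^ l * ((n + 1).choose l : ℂ)) *
        longTranslate (fun m => ((b * (j + 1 - l) : ℕ) : ℂ) ^ m) π)) =
      ∑ r ∈ Finset.range n, ((-1 : ℂ) ^ k * ((n + 1).choose k : ℂ) *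
        ((i + 1 - k + n - 1 - r).choose n : ℂ)) * ((n.factorial * ((n - 1).factorial : ℂ) ^ 2) *
        ((b : ℂ) ^ n)⁻¹ * ∑ l ∈ Finset.range ((j : ℕ) + 1), (-1 : ℂ) ^ l *
          ((n + 1).choose l : ℂ) * ((b * (j + 1 - l) + n - 1 - r).choose n : ℂ)) := by
    intro k _
    rw [Finset.sum_comm]
    simp only [Finset.mul_sum]
    rw [Finset.sum_comm (s := Finset.range n)]
    refine Finset.sum_congr rfl fun l _ => ?_
    have h4 := sum_longTranslate_pow (n := n) hn (i + 1 - k) (b * (j + 1 - l))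
    calc _ = (-1 : ℂ) ^ k * ((n + 1).choose k : ℂ) * (((b : ℂ) ^ n)⁻¹ * ((-1 : ℂ) ^ l *
          ((n + 1).choose l : ℂ))) * ∑ π : Perm (Fin n),
            longTranslate (fun l => ((i + 1 - k : ℕ) : ℂ) ^ l) π *
            longTranslate (fun m => ((b * (j + 1 - l) : ℕ) : ℂ) ^ m) π := by
          rw [Finset.mul_sum]
          exact Finset.sum_congr rfl fun π _ => by ring
      _ = _ := by
          rw [h4, Finset.mul_sum, Finset.mul_sum]
          exact Finset.sum_congr rfl fun r _ => by ring
  rw [Finset.sum_congr rfl h3, Finset.sum_comm]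
  -- The coefficients of `φ_i` invert the binomials, so only `r = i` survives in the diagonal
  -- pairing.
  have h5 : ∀ r ∈ Finset.range n, (∑ k ∈ Finset.range ((i : ℕ) + 1),
      ((-1 : ℂ) ^ k * ((n + 1).choose k : ℂ) *
        ((i + 1 - k + n - 1 - r).choose n : ℂ)) * ((n.factorial * ((n - 1).factorial : ℂ) ^ 2) *
        ((b : ℂ) ^ n)⁻¹ * ∑ l ∈ Finset.range ((j : ℕ) + 1), (-1 : ℂ) ^ l *
          ((n + 1).choose l : ℂ) * ((b * (j + 1 - l) + n - 1 - r).choose n : ℂ))) =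
      if (i : ℕ) = r then ((n.factorial * ((n - 1).factorial : ℂ) ^ 2) *
        ((b : ℂ) ^ n)⁻¹ * ∑ l ∈ Finset.range ((j : ℕ) + 1), (-1 : ℂ) ^ l *
          ((n + 1).choose l : ℂ) * ((b * (j + 1 - l) + n - 1 - r).choose n : ℂ)) else 0 := by
    intro r hr
    rw [← Finset.sum_mul, sum_choose_mul_choose_eq_ite i.isLt (Finset.mem_range.1 hr), ite_mul,
      one_mul, zero_mul]
  rw [Finset.sum_congr rfl h5, Finset.sum_ite_eq, if_pos (Finset.mem_range.2 i.isLt), mul_assoc,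
    inv_mul_cancel_left₀]
  exact mul_ne_zero (Nat.cast_ne_zero.2 (Nat.factorial_ne_zero _))
    (pow_ne_zero _ (Nat.cast_ne_zero.2 (Nat.factorial_ne_zero _)))

end Bracket

end FoulkesCarries
end

noncomputable section
namespace FoulkesCarries

open Equiv Equiv.Perm

/-! ### Row and column sums in the group algebra -/

section Sums

variable {n : ℕ}

/-- The permutations that preserve the fibres of `f`. -/
def fiberPerms (f : Fin n → ℤ) : Finset (Perm (Fin n)) :=
  Finset.univ.filter fun p => ∀ m, f (p m) = f m

lemma mem_fiberPerms {f : Fin n → ℤ} {p : Perm (Fin n)} :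
    p ∈ fiberPerms f ↔ ∀ m, f (p m) = f m := by simp [fiberPerms]

lemma one_mem_fiberPerms (f : Fin n → ℤ) : 1 ∈ fiberPerms f := by simp [mem_fiberPerms]

lemma fiberPerms_mul {f : Fin n → ℤ} {p q : Perm (Fin n)} (hp : p ∈ fiberPerms f)
    (hq : q ∈ fiberPerms f) : p * q ∈ fiberPerms f := by
  rw [mem_fiberPerms] at *
  intro m
  rw [Perm.mul_apply, hp, hq]

lemma fiberPerms_inv {f : Fin n → ℤ} {p : Perm (Fin n)} (hp : p ∈ fiberPerms f) :
    p⁻¹ ∈ fiberPerms f := by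
  rw [mem_fiberPerms] at *
  intro m
  rw [← hp (p⁻¹ m)]
  simp

lemma swap_mem_fiberPerms {f : Fin n → ℤ} {a b : Fin n} (h : f a = f b) :
    swap a b ∈ fiberPerms f := by
  rw [mem_fiberPerms]
  intro m
  by_cases ha : m = a
  · rw [ha, swap_apply_left, h]
  by_cases hb : m = b
  · rw [hb, swap_apply_right, h]
  · rw [swap_apply_of_ne_of_ne ha hb]

lemma rowSum_eq (f : Fin n → ℤ) :
    rowSum f = ∑ p ∈ fiberPerms f, MonoidAlgebra.of ℂ (Perm (Fin n)) p := by
  rw [rowSum, fiberPerms]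

lemma colSignedSum_eq (f : Fin n → ℤ) :
    colSignedSum f = ∑ p ∈ fiberPerms f,
      ((sign p : ℤ) : ℂ) • MonoidAlgebra.of ℂ (Perm (Fin n)) p := by
  rw [colSignedSum, fiberPerms]

lemma of_mul_rowSum {f : Fin n → ℤ} {q : Perm (Fin n)} (hq : q ∈ fiberPerms f) :
    MonoidAlgebra.of ℂ _ q * rowSum f = rowSum f := by
  rw [rowSum_eq, Finset.mul_sum]
  refine Finset.sum_nbij' (fun p => q * p) (fun p => q⁻¹ * p) ?_ ?_ ?_ ?_ ?_
  · exact fun p hp => fiberPerms_mul hq hp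
  · exact fun p hp => fiberPerms_mul (fiberPerms_inv hq) hp
  · intro p _; simp
  · intro p _; simp
  · intro p _; rw [map_mul]

lemma rowSum_mul_of {f : Fin n → ℤ} {q : Perm (Fin n)} (hq : q ∈ fiberPerms f) :
    rowSum f * MonoidAlgebra.of ℂ _ q = rowSum f := by
  rw [rowSum_eq, Finset.sum_mul]
  refine Finset.sum_nbij' (fun p => p * q) (fun p => p * q⁻¹) ?_ ?_ ?_ ?_ ?_
  · exact fun p hp => fiberPerms_mul hp hq
  · exact fun p hp => fiberPerms_mul hp (fiberPerms_inv hq)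
  · intro p _; simp
  · intro p _; simp
  · intro p _; rw [map_mul]

lemma of_mul_colSignedSum {f : Fin n → ℤ} {q : Perm (Fin n)} (hq : q ∈ fiberPerms f) :
    MonoidAlgebra.of ℂ _ q * colSignedSum f = ((sign q : ℤ) : ℂ) • colSignedSum f := by
  rw [colSignedSum_eq, Finset.mul_sum, Finset.smul_sum]
  refine Finset.sum_nbij' (fun p => q * p) (fun p => q⁻¹ * p) ?_ ?_ ?_ ?_ ?_
  · exact fun p hp => fiberPerms_mul hq hp
  · exact fun p hp => fiberPerms_mul (fiberPerms_inv hq) hp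
  · intro p _; simp
  · intro p _; simp
  · intro p _
    simp only [map_mul (sign), Units.val_mul, Int.cast_mul, smul_smul]
    rw [← mul_assoc, sign_cast_mul_self, one_mul, mul_smul_comm, map_mul]

lemma rowSum_mul_colSignedSum_eq_zero {f g : Fin n → ℤ} {a b : Fin n} (hab : a ≠ b)
    (hf : f a = f b) (hg : g a = g b) : rowSum f * colSignedSum g = 0 := by
  have h1 : rowSum f * colSignedSum g = -(rowSum f * colSignedSum g) := by
    nth_rewrite 1 [← rowSum_mul_of (swap_mem_fiberPerms hf)]
    rw [mul_assoc, of_mul_colSignedSum (swap_mem_fiberPerms hg), sign_swap hab]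
    simp
  have h2 := eq_neg_iff_add_eq_zero.1 h1
  rw [← two_smul ℂ] at h2
  exact (smul_eq_zero.1 h2).resolve_left two_ne_zero

lemma rowSum_mul_rowSum {f g : Fin n → ℤ} (h : fiberPerms f ⊆ fiberPerms g) :
    rowSum g * rowSum f = ((fiberPerms f).card : ℂ) • rowSum g := by
  rw [rowSum_eq f, Finset.mul_sum, Finset.sum_congr rfl fun q hq => rowSum_mul_of (h hq),
    Finset.sum_const, Nat.cast_smul_eq_nsmul]

/-- The standard Hermitian form on the group algebra. -/
def coeffInner (a b : SymAlg n) : ℂ := ∑ g, a.coeff g * (starRingEnd ℂ) (b.coeff g)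

lemma coeffInner_self_eq_zero {a : SymAlg n} (h : coeffInner a a = 0) : a = 0 := by
  have h1 : ((∑ g, Complex.normSq (a.coeff g) : ℝ) : ℂ) = 0 := by
    rw [← h, coeffInner]
    push_cast
    exact Finset.sum_congr rfl fun g _ => (Complex.mul_conj _).symm
  rw [Complex.ofReal_eq_zero, Finset.sum_eq_zero_iff_of_nonneg
    (fun g _ => Complex.normSq_nonneg _)] at h1
  ext g
  simpa using h1 g (Finset.mem_univ g)

lemma coeff_mul_rowSum (a : SymAlg n) (f : Fin n → ℤ) (g : Perm (Fin n)) :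
    (a * rowSum f).coeff g = ∑ p ∈ fiberPerms f, a.coeff (g * p⁻¹) := by
  rw [rowSum_eq, Finset.mul_sum, MonoidAlgebra.coeff_sum, Finset.sum_apply']
  refine Finset.sum_congr rfl fun p _ => ?_
  rw [MonoidAlgebra.of_apply, MonoidAlgebra.coeff_mul_single_apply, mul_one]

lemma coeff_mul_colSignedSum (a : SymAlg n) (f : Fin n → ℤ) (g : Perm (Fin n)) :
    (a * colSignedSum f).coeff g =
      ∑ p ∈ fiberPerms f, ((sign p : ℤ) : ℂ) * a.coeff (g * p⁻¹) := by
  rw [colSignedSum_eq, Finset.mul_sum, MonoidAlgebra.coeff_sum, Finset.sum_apply']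
  refine Finset.sum_congr rfl fun p _ => ?_
  rw [mul_smul_comm, MonoidAlgebra.coeff_smul_apply, MonoidAlgebra.of_apply,
    MonoidAlgebra.coeff_mul_single_apply, mul_one, smul_eq_mul]

lemma coeffInner_mul_rowSum (a b : SymAlg n) (f : Fin n → ℤ) :
    coeffInner (a * rowSum f) b = coeffInner a (b * rowSum f) := by
  simp only [coeffInner, coeff_mul_rowSum, map_sum, Finset.sum_mul, Finset.mul_sum]
  rw [Finset.sum_comm, Finset.sum_comm (s := Finset.univ)]
  refine Finset.sum_nbij' (fun p => p⁻¹) (fun p => p⁻¹) (fun p hp => fiberPerms_inv hp)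
    (fun p hp => fiberPerms_inv hp) (fun p _ => inv_inv p) (fun p _ => inv_inv p) ?_
  intro p _
  refine Fintype.sum_equiv (Equiv.mulRight p⁻¹) _ _ fun g => ?_
  simp

lemma coeffInner_mul_colSignedSum (a b : SymAlg n) (f : Fin n → ℤ) :
    coeffInner (a * colSignedSum f) b = coeffInner a (b * colSignedSum f) := by
  simp only [coeffInner, coeff_mul_colSignedSum, map_sum, Finset.sum_mul, Finset.mul_sum]
  rw [Finset.sum_comm, Finset.sum_comm (s := Finset.univ)]
  refine Finset.sum_nbij' (fun p => p⁻¹) (fun p => p⁻¹) (fun p hp => fiberPerms_inv hp)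
    (fun p hp => fiberPerms_inv hp) (fun p _ => inv_inv p) (fun p _ => inv_inv p) ?_
  intro p _
  refine Fintype.sum_equiv (Equiv.mulRight p⁻¹) _ _ fun g => ?_
  simp
  ring

/-- Right multiplication by row sums `R` and by signed column sums `C` is self-adjoint, and `R * R`
is a multiple of `R`. So the squared norm of `a * C * R` is a multiple of the inner product of `a`
with `a * C * R * C`, and positivity finishes. -/
lemma mul_rowSum_eq_zero_of_mul_colSignedSum {a : SymAlg n} {f g : Fin n → ℤ}
    (h : a * colSignedSum g * rowSum f * colSignedSum g = 0) :
    a * colSignedSum g * rowSum f = 0 := by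
  apply coeffInner_self_eq_zero
  rw [coeffInner_mul_rowSum, mul_assoc _ (rowSum f) (rowSum f),
    rowSum_mul_rowSum (Finset.Subset.refl _), mul_smul_comm, coeffInner_mul_colSignedSum]
  rw [smul_mul_assoc, h]
  simp [coeffInner]

end Sums

end FoulkesCarries
end

noncomputable section
namespace FoulkesCarries

open Equiv Equiv.Perm

/-! ### Descents and border shapes -/

section Descents

variable {n : ℕ}

/-- The row of the box `m` in the border shape that goes up after the boxes in `D`. -/
def rowFn (n : ℕ) (D : Finset ℕ) (m : Fin n) : ℤ := ((D.filter fun j => j < (m : ℕ)).card : ℤ)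

/-- The column of the box `m` in the border shape that goes up after the boxes in `D`. -/
def colFn (n : ℕ) (D : Finset ℕ) (m : Fin n) : ℤ := ((m : ℕ) : ℤ) - rowFn n D m

lemma rowFn_succ (D : Finset ℕ) {j : ℕ} (hj : j + 1 < n) :
    rowFn n D ⟨j + 1, hj⟩ = rowFn n D ⟨j, by omega⟩ + if j ∈ D then 1 else 0 := by
  simp only [rowFn]
  have h1 : (D.filter fun i => i < j + 1) =
      (D.filter fun i => i < j) ∪ (if j ∈ D then {j} else ∅) := by
    ext i
    simp only [Finset.mem_filter, Finset.mem_union]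
    split_ifs with h
    · simp only [Finset.mem_singleton]
      constructor
      · rintro ⟨h1, h2⟩
        rcases Nat.lt_succ_iff_lt_or_eq.1 h2 with h3 | h3
        · exact Or.inl ⟨h1, h3⟩
        · exact Or.inr h3
      · rintro (⟨h1, h2⟩ | rfl)
        · exact ⟨h1, by omega⟩
        · exact ⟨h, by omega⟩
    · simp only [Finset.notMem_empty, or_false]
      refine and_congr_right fun h1 => ⟨fun h2 => ?_, fun h2 => by omega⟩
      have : i ≠ j := fun e => h (e ▸ h1)
      omega
  rw [h1, Finset.card_union_of_disjoint]
  · split_ifs <;> simp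
  · rw [Finset.disjoint_left]
    intro i hi
    have := (Finset.mem_filter.1 hi).2
    split_ifs
    · simp only [Finset.mem_singleton]; omega
    · simp

lemma colFn_succ (D : Finset ℕ) {j : ℕ} (hj : j + 1 < n) :
    colFn n D ⟨j + 1, hj⟩ = colFn n D ⟨j, by omega⟩ + if j ∈ D then 0 else 1 := by
  simp only [colFn, rowFn_succ]
  split_ifs <;> push_cast <;> ring

lemma rowFn_eq_iff (D : Finset ℕ) {a b : Fin n} (hab : a ≤ b) :
    rowFn n D a = rowFn n D b ↔ ∀ j ∈ D, (a : ℕ) ≤ j → (b : ℕ) ≤ j := by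
  have hsub : (D.filter fun j => j < (a : ℕ)) ⊆ D.filter fun j => j < (b : ℕ) := by
    intro j hj
    rw [Finset.mem_filter] at *
    exact ⟨hj.1, hj.2.trans_le hab⟩
  rw [rowFn, rowFn, Nat.cast_inj]
  constructor
  · intro h j hj haj
    have h1 := Finset.eq_of_subset_of_card_le hsub h.symm.le
    by_contra hbj
    have h2 : j ∈ D.filter fun j => j < (b : ℕ) := Finset.mem_filter.2 ⟨hj, not_le.1 hbj⟩
    rw [← h1, Finset.mem_filter] at h2
    omega
  · intro h
    congr 1
    refine Finset.Subset.antisymm hsub fun j hj => ?_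
    rw [Finset.mem_filter] at *
    refine ⟨hj.1, ?_⟩
    by_contra h1
    have := h j hj.1 (not_lt.1 h1)
    omega

lemma fiberPerms_rowFn_mono {D D' : Finset ℕ} (h : D ⊆ D') :
    fiberPerms (rowFn n D') ⊆ fiberPerms (rowFn n D) := by
  intro p hp
  rw [mem_fiberPerms] at *
  intro m
  rcases le_total (p m) m with hm | hm
  · rw [rowFn_eq_iff D hm]
    exact fun j hj => (rowFn_eq_iff D' hm).1 (hp m) j (h hj)
  · symm
    rw [rowFn_eq_iff D hm]
    exact fun j hj => (rowFn_eq_iff D' hm).1 (hp m).symm j (h hj)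

/-- The descents of a permutation. -/
def descents (w : Perm (Fin n)) : Finset ℕ :=
  (Finset.range (n - 1)).filter fun j =>
    ∃ h : j + 1 < n, w ⟨j + 1, h⟩ < w ⟨j, by omega⟩

lemma mem_descents {w : Perm (Fin n)} {j : ℕ} (h : j + 1 < n) :
    j ∈ descents w ↔ w ⟨j + 1, h⟩ < w ⟨j, by omega⟩ := by
  rw [descents, Finset.mem_filter, Finset.mem_range]
  exact ⟨fun ⟨_, _, h2⟩ => h2, fun h2 => ⟨by omega, h, h2⟩⟩

lemma descents_subset (w : Perm (Fin n)) : descents w ⊆ Finset.range (n - 1) :=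
  Finset.filter_subset _ _

lemma strictMono_of_succ {f : Fin n → ℤ}
    (h : ∀ (j : ℕ) (hj : j + 1 < n), f ⟨j, by omega⟩ < f ⟨j + 1, hj⟩) : StrictMono f := by
  cases n with
  | zero => exact fun a => a.elim0
  | succ k =>
    rw [Fin.strictMono_iff_lt_succ]
    exact fun i => h i (by omega)

/-- The major statistic `∑ m w(m)` of a function. -/
def moment (W : Fin n → ℤ) : ℤ := ∑ m : Fin n, ((m : ℕ) : ℤ) * W m

/-- The rearrangement inequality. Permuting inside the fibres of `r` leaves the contribution of `N *
r` unchanged, so only the moment of `W` varies; strictness makes the identity the only maximizer. -/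
lemma moment_comp_perm_le {W r : Fin n → ℤ} {N : ℤ} (hW : StrictMono fun m => W m + N * r m)
    {v : Perm (Fin n)} (hv : v ∈ fiberPerms r) :
    moment (fun m => W (v m)) ≤ moment W ∧
      (moment (fun m => W (v m)) = moment W → v = 1) := by
  rw [mem_fiberPerms] at hv
  have hid : StrictMono fun m : Fin n => ((m : ℕ) : ℤ) := fun a b hab => by
    simpa using hab
  have hmono : Monovary (fun m : Fin n => ((m : ℕ) : ℤ)) fun m => W m + N * r m :=
    fun a b hab => hid.monotone (hW.lt_iff_lt.1 hab).le
  have e1 : ∑ m : Fin n, ((m : ℕ) : ℤ) * (W (v m) + N * r (v m)) =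
      moment (fun m => W (v m)) + N * ∑ m : Fin n, ((m : ℕ) : ℤ) * r m := by
    simp only [hv, mul_add, Finset.sum_add_distrib, moment, Finset.mul_sum]
    congr 1
    exact Finset.sum_congr rfl fun m _ => by ring
  have e2 : ∑ m : Fin n, ((m : ℕ) : ℤ) * (W m + N * r m) =
      moment W + N * ∑ m : Fin n, ((m : ℕ) : ℤ) * r m := by
    simp only [mul_add, Finset.sum_add_distrib, moment, Finset.mul_sum]
    congr 1
    exact Finset.sum_congr rfl fun m _ => by ring
  have h1 := hmono.sum_mul_comp_perm_le_sum_mul (σ := v)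
  have h2 := hmono.sum_mul_comp_perm_eq_sum_mul_iff (σ := v)
  rw [e1, e2] at h1 h2
  refine ⟨by linarith, fun h => ?_⟩
  have h3 := h2.1 (by rw [h])
  have hvm : StrictMono (v⁻¹ : Perm (Fin n)) := by
    have hm : Monotone (v⁻¹ : Perm (Fin n)) := by
      intro a b hab
      rcases hab.eq_or_lt with rfl | hlt
      · exact le_rfl
      · have h4 := @h3 (v⁻¹ a) (v⁻¹ b) (by simpa using hW hlt)
        simpa using h4
    exact hm.strictMono_of_injective (v⁻¹).injective
  have h5 : (v⁻¹ : Perm (Fin n)) = (id : Fin n → Fin n) :=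
    (hvm.range_inj strictMono_id).1 (by rw [(v⁻¹).surjective.range_eq, Set.range_id])
  have h6 : v⁻¹ = 1 := Equiv.ext fun a => congrFun h5 a
  exact inv_eq_one.1 h6

/-- The moment of a permutation. -/
def permMoment (w : Perm (Fin n)) : ℤ := moment fun m => ((w m : ℕ) : ℤ)

/-- Such a `w` increases along rows, so it is the strict maximum of its row coset. Weighting the row
by `n` outweighs any drop of `w` at an up step. -/
lemma permMoment_mul_le_of_row {w v : Perm (Fin n)} {D : Finset ℕ} (hw : descents w ⊆ D)
    (hv : v ∈ fiberPerms (rowFn n D)) :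
    permMoment (w * v) ≤ permMoment w ∧ (permMoment (w * v) = permMoment w → v = 1) := by
  refine moment_comp_perm_le (W := fun m => ((w m : ℕ) : ℤ)) (N := n) (strictMono_of_succ ?_) hv
  intro j hj
  rw [rowFn_succ D hj]
  have h1 := (w ⟨j, by omega⟩).isLt
  split_ifs with h
  · have : (0 : ℤ) ≤ (w ⟨j + 1, hj⟩ : ℕ) := by positivity
    have h2 : ((w ⟨j, by omega⟩ : ℕ) : ℤ) < n := by exact_mod_cast h1
    linarith
  · have h2 : ¬ w ⟨j + 1, hj⟩ < w ⟨j, by omega⟩ := fun h3 => h (hw ((mem_descents hj).2 h3))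
    have h3 : w ⟨j, by omega⟩ ≠ w ⟨j + 1, hj⟩ := by simp
    have h4 : ((w ⟨j, by omega⟩ : ℕ) : ℤ) < (w ⟨j + 1, hj⟩ : ℕ) := by
      exact_mod_cast lt_of_le_of_ne (not_lt.1 h2) h3
    linarith

/-- Dually, `w` decreases along each column in the numbering of the boxes, so it is the strict
minimum of its column coset; the row argument is applied to `-w`. -/
lemma permMoment_le_mul_of_col {w u : Perm (Fin n)} {D : Finset ℕ} (hw : D ⊆ descents w)
    (hu : u ∈ fiberPerms (colFn n D)) :
    permMoment w ≤ permMoment (w * u) ∧ (permMoment (w * u) = permMoment w → u = 1) := by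
  have hneg : ∀ x : Perm (Fin n), moment (fun m => -((x m : ℕ) : ℤ)) = -permMoment x := by
    intro x
    simp [moment, permMoment]
  have h := moment_comp_perm_le (W := fun m => -((w m : ℕ) : ℤ)) (r := colFn n D) (N := n)
    (strictMono_of_succ ?_) hu
  · have h1 := hneg w
    have h2 := hneg (w * u)
    simp only [Perm.mul_apply] at h2
    rw [h1, h2] at h
    exact ⟨by linarith [h.1], fun e => h.2 (by rw [e])⟩
  intro j hj
  rw [colFn_succ D hj]
  have h1 := (w ⟨j + 1, hj⟩).isLt
  split_ifs with h
  · have h2 : ((w ⟨j + 1, hj⟩ : ℕ) : ℤ) < (w ⟨j, by omega⟩ : ℕ) := by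
      exact_mod_cast (mem_descents hj).1 (hw h)
    linarith
  · have : (0 : ℤ) ≤ (w ⟨j, by omega⟩ : ℕ) := by positivity
    have h2 : ((w ⟨j + 1, hj⟩ : ℕ) : ℤ) < n := by exact_mod_cast h1
    linarith

lemma permMoment_lt_mul_swap {w : Perm (Fin n)} {j : ℕ} (hj : j + 1 < n) (h : j ∈ descents w) :
    permMoment w < permMoment (w * swap ⟨j, by omega⟩ ⟨j + 1, hj⟩) := by
  set a : Fin n := ⟨j, by omega⟩
  set b : Fin n := ⟨j + 1, hj⟩
  have hab : a ≠ b := by simp [a, b]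
  have h1 : ((w b : ℕ) : ℤ) < (w a : ℕ) := by exact_mod_cast (mem_descents hj).1 h
  have h2 : permMoment (w * swap a b) = ∑ m : Fin n, ((swap a b m : ℕ) : ℤ) * ((w m : ℕ) : ℤ) := by
    rw [permMoment, moment]
    refine Fintype.sum_equiv (swap a b) _ _ fun m => ?_
    simp
  have h3 : permMoment (w * swap a b) - permMoment w =
      ((w a : ℕ) : ℤ) - ((w b : ℕ) : ℤ) := by
    rw [h2, permMoment, moment, ← Finset.sum_sub_distrib,
      Finset.sum_eq_add_of_mem a b (Finset.mem_univ _) (Finset.mem_univ _) hab]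
    · rw [swap_apply_left, swap_apply_right]
      simp only [a, b]
      push_cast
      ring
    · intro m _ hm
      rw [swap_apply_of_ne_of_ne hm.1 hm.2, sub_self]
  linarith

end Descents

end FoulkesCarries
end

noncomputable section
namespace FoulkesCarries

open Equiv Equiv.Perm

/-! ### The decomposition of the permutation modules -/

section Decomposition

variable {n : ℕ}

/-- The Specht module of a border shape, as a complex vector space. -/
def borderSpecht (n : ℕ) (D : Finset ℕ) : Submodule ℂ (SymAlg n) :=
  (spechtModule (rowFn n D) (colFn n D)).restrictScalars ℂ

/-- The permutation module of row tabloids of a border shape. -/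
def borderTabloid (n : ℕ) (D : Finset ℕ) : Submodule ℂ (SymAlg n) :=
  (Submodule.span (SymAlg n) {rowSum (rowFn n D)}).restrictScalars ℂ

lemma mem_borderSpecht {D : Finset ℕ} {x : SymAlg n} : x ∈ borderSpecht n D ↔
    ∃ a, a * (colSignedSum (colFn n D) * rowSum (rowFn n D)) = x := by
  rw [borderSpecht, Submodule.restrictScalars_mem, spechtModule, Submodule.mem_span_singleton]
  rfl

lemma mem_borderTabloid {D : Finset ℕ} {x : SymAlg n} : x ∈ borderTabloid n D ↔
    ∃ a, a * rowSum (rowFn n D) = x := by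
  rw [borderTabloid, Submodule.restrictScalars_mem, Submodule.mem_span_singleton]
  rfl

lemma card_fiberPerms_ne_zero (f : Fin n → ℤ) : ((fiberPerms f).card : ℂ) ≠ 0 :=
  Nat.cast_ne_zero.2 (Finset.card_pos.2 ⟨1, one_mem_fiberPerms f⟩).ne'

/-- More up steps cut the rows more finely, so elements invariant under the row group of `D` are
invariant under that of `D'`. -/
lemma borderSpecht_le_borderTabloid {D D' : Finset ℕ} (h : D ⊆ D') :
    borderSpecht n D ≤ borderTabloid n D' := by
  intro x hx
  obtain ⟨a, rfl⟩ := mem_borderSpecht.1 hx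
  rw [mem_borderTabloid]
  refine ⟨((fiberPerms (rowFn n D')).card : ℂ)⁻¹ •
    (a * (colSignedSum (colFn n D) * rowSum (rowFn n D))), ?_⟩
  rw [smul_mul_assoc, mul_assoc, mul_assoc, rowSum_mul_rowSum (fiberPerms_rowFn_mono h),
    mul_smul_comm, mul_smul_comm, smul_smul, inv_mul_cancel₀ (card_fiberPerms_ne_zero _), one_smul]

/-- For `j ∈ D' \ D`, the boxes `j` and `j + 1` share a row of `D` and a column of `D'`. -/
lemma rowSum_mul_colSignedSum_eq_zero_of_not_subset {D D' : Finset ℕ}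
    (hD' : D' ⊆ Finset.range (n - 1)) (h : ¬ D' ⊆ D) :
    rowSum (rowFn n D) * colSignedSum (colFn n D') = 0 := by
  obtain ⟨j, hj', hj⟩ := Finset.not_subset.1 h
  have hjn : j + 1 < n := by have := Finset.mem_range.1 (hD' hj'); omega
  refine rowSum_mul_colSignedSum_eq_zero (a := ⟨j, by omega⟩) (b := ⟨j + 1, hjn⟩) (by simp) ?_ ?_
  · rw [rowFn_succ, if_neg hj, add_zero]
  · rw [colFn_succ, if_pos hj', add_zero]

lemma eq_zero_of_sum_borderSpecht {s : Finset (Finset ℕ)}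
    (hs : ∀ D ∈ s, D ⊆ Finset.range (n - 1)) {v : Finset ℕ → SymAlg n}
    (hv : ∀ D ∈ s, v D ∈ borderSpecht n D) (h0 : ∑ D ∈ s, v D = 0) : ∀ D ∈ s, v D = 0 := by
  classical
  by_contra! hne
  obtain ⟨D, hD, hvD⟩ := hne
  -- Multiplying by the signed column sum of a largest `D₀` kills every other nonzero term, since no
  -- other such `E` contains `D₀`.
  obtain ⟨D₀, hD₀, hmax⟩ := Finset.exists_max_image (s.filter fun D => v D ≠ 0) Finset.card
    ⟨D, Finset.mem_filter.2 ⟨hD, hvD⟩⟩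
  rw [Finset.mem_filter] at hD₀
  apply hD₀.2
  have h1 : v D₀ * colSignedSum (colFn n D₀) = 0 := by
    rw [← Finset.sum_eq_single_of_mem (f := fun D => v D * colSignedSum (colFn n D₀)) D₀ hD₀.1,
      ← Finset.sum_mul, h0, zero_mul]
    intro E hE hne
    by_cases hvE : v E = 0
    · rw [hvE, zero_mul]
    obtain ⟨a, ha⟩ := mem_borderSpecht.1 (hv E hE)
    rw [← ha, mul_assoc, mul_assoc, rowSum_mul_colSignedSum_eq_zero_of_not_subset (hs D₀ hD₀.1),
      mul_zero, mul_zero]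
    intro hsub
    exact hne (Finset.eq_of_subset_of_card_le hsub
      (hmax E (Finset.mem_filter.2 ⟨hE, hvE⟩))).symm
  obtain ⟨a, ha⟩ := mem_borderSpecht.1 (hv D₀ hD₀.1)
  rw [← ha, ← mul_assoc] at h1 ⊢
  exact mul_rowSum_eq_zero_of_mul_colSignedSum h1

/-- The polytabloid attached to a permutation, for the border shape of its descents. -/
def descentPolytabloid (w : Perm (Fin n)) : SymAlg n :=
  MonoidAlgebra.of ℂ _ w *
    (colSignedSum (colFn n (descents w)) * rowSum (rowFn n (descents w)))

lemma descentPolytabloid_mem (w : Perm (Fin n)) :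
    descentPolytabloid w ∈ borderSpecht n (descents w) := mem_borderSpecht.2 ⟨_, rfl⟩

lemma coeff_descentPolytabloid (w x : Perm (Fin n)) : (descentPolytabloid w).coeff x =
    ∑ v ∈ fiberPerms (rowFn n (descents w)), ∑ u ∈ fiberPerms (colFn n (descents w)),
      if w * u * v = x then ((sign u : ℤ) : ℂ) else 0 := by
  rw [descentPolytabloid, ← mul_assoc, coeff_mul_rowSum]
  refine Finset.sum_congr rfl fun v _ => ?_
  rw [coeff_mul_colSignedSum]
  refine Finset.sum_congr rfl fun u _ => ?_
  rw [MonoidAlgebra.of_apply, MonoidAlgebra.coeff_single, Finsupp.single_apply]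
  have : w = x * v⁻¹ * u⁻¹ ↔ w * u * v = x := by
    rw [eq_mul_inv_iff_mul_eq, eq_mul_inv_iff_mul_eq]
  simp only [this, mul_ite, mul_one, mul_zero]

/-- Going from `w` to `w * u` cannot lower the moment, `w` being minimal in its column coset. Going
on to `w * u * v` cannot either, since that element is maximal in its row coset. This makes
polytabloids with equal descents unitriangular. -/
lemma permMoment_le_of_mul {w u v : Perm (Fin n)} (h : descents (w * u * v) = descents w)
    (hu : u ∈ fiberPerms (colFn n (descents w))) (hv : v ∈ fiberPerms (rowFn n (descents w))) :
    permMoment w ≤ permMoment (w * u * v) ∧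
      (permMoment (w * u * v) ≤ permMoment w → u = 1 ∧ v = 1) := by
  have h1 := permMoment_le_mul_of_col (Finset.Subset.refl _) hu
  have h2 := permMoment_mul_le_of_row (w := w * u * v) h.subset (fiberPerms_inv hv)
  rw [mul_inv_cancel_right] at h2
  refine ⟨h1.1.trans h2.1, fun h3 => ⟨h1.2 (le_antisymm (h2.1.trans h3) h1.1), ?_⟩⟩
  exact inv_eq_one.1 (h2.2 (le_antisymm h2.1 (h3.trans h1.1)))

lemma coeff_descentPolytabloid_self (w : Perm (Fin n)) : (descentPolytabloid w).coeff w = 1 := by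
  rw [coeff_descentPolytabloid, Finset.sum_eq_single_of_mem 1 (one_mem_fiberPerms _),
    Finset.sum_eq_single_of_mem 1 (one_mem_fiberPerms _)]
  · simp
  · intro u hu hu1
    rw [if_neg]
    simpa using hu1
  · intro v hv hv1
    refine Finset.sum_eq_zero fun u hu => if_neg fun h => hv1 ?_
    exact ((permMoment_le_of_mul (by rw [h]) hu hv).2 (by rw [h])).2

lemma coeff_descentPolytabloid_eq_zero {w x : Perm (Fin n)} (hd : descents x = descents w)
    (hx : permMoment x ≤ permMoment w) (hne : w ≠ x) : (descentPolytabloid w).coeff x = 0 := by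
  rw [coeff_descentPolytabloid]
  refine Finset.sum_eq_zero fun v hv => Finset.sum_eq_zero fun u hu => if_neg fun h => hne ?_
  obtain ⟨rfl, rfl⟩ := (permMoment_le_of_mul (by rw [h, hd]) hu hv).2 (by rw [h]; exact hx)
  simpa using h

lemma linearIndepOn_descentPolytabloid {D : Finset ℕ} (hD : D ⊆ Finset.range (n - 1)) :
    LinearIndepOn ℂ (descentPolytabloid (n := n))
      (Finset.univ.filter fun w : Perm (Fin n) => descents w ⊆ D) := by
  classical
  rw [linearIndepOn_finset_iff]
  intro g hg
  by_contra! hne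
  obtain ⟨w, hw, hgw⟩ := hne
  set s := Finset.univ.filter fun w : Perm (Fin n) => descents w ⊆ D
  let v : Finset ℕ → SymAlg n := fun E =>
    ∑ w ∈ s.filter fun w => descents w = E, g w • descentPolytabloid w
  have hsum : ∑ E ∈ D.powerset, v E = 0 := by
    rw [← hg]
    refine Finset.sum_fiberwise_of_maps_to (fun w hw => ?_) _
    rw [Finset.mem_powerset]
    exact (Finset.mem_filter.1 hw).2
  have hv : ∀ E ∈ D.powerset, v E ∈ borderSpecht n E := by
    intro E _
    refine Submodule.sum_mem _ fun w hw => Submodule.smul_mem _ _ ?_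
    rw [← (Finset.mem_filter.1 hw).2]
    exact descentPolytabloid_mem w
  have h0 := eq_zero_of_sum_borderSpecht
    (fun E hE => (Finset.mem_powerset.1 hE).trans hD) hv hsum (descents w)
    (Finset.mem_powerset.2 (Finset.mem_filter.1 hw).2)
  -- Different descent sets are already separated. Within one of them, only `w₁` contributes to the
  -- coefficient at the `w₁` of least moment.
  obtain ⟨w₁, hw₁, hmin⟩ := Finset.exists_min_image
    ((s.filter fun x => descents x = descents w).filter fun x => g x ≠ 0) permMoment
    ⟨w, by simp [hw, hgw]⟩
  simp only [Finset.mem_filter] at hw₁ hmin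
  have h1 := congrArg (fun z => z.coeff w₁) h0
  simp only [v, MonoidAlgebra.coeff_sum, Finset.sum_apply', MonoidAlgebra.coeff_smul_apply,
    MonoidAlgebra.coeff_zero, Finsupp.coe_zero, Pi.zero_apply] at h1
  rw [Finset.sum_eq_single_of_mem w₁ (Finset.mem_filter.2 hw₁.1), coeff_descentPolytabloid_self]
    at h1
  · exact hw₁.2 (by simpa using h1)
  · intro x hx hne
    by_cases hgx : g x = 0
    · rw [hgx, zero_smul]
    · rw [Finset.mem_filter] at hx
      rw [coeff_descentPolytabloid_eq_zero (hw₁.1.2.trans hx.2.symm) (hmin x ⟨hx, hgx⟩) hne,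
        smul_zero]

instance : Module.Finite ℂ (SymAlg n) :=
  Module.Finite.of_basis (MonoidAlgebra.basis (Perm (Fin n)) ℂ)

/-- The element of largest moment in a coset of the row group has descents only in `D`: a descent
inside a row could be swapped to increase the moment. -/
lemma finrank_borderTabloid_le (D : Finset ℕ) : Module.finrank ℂ (borderTabloid n D) ≤
    (Finset.univ.filter fun w : Perm (Fin n) => descents w ⊆ D).card := by
  classical
  set s := Finset.univ.filter fun w : Perm (Fin n) => descents w ⊆ D
  have hgen : ∀ g : Perm (Fin n), ∃ w ∈ s, MonoidAlgebra.of ℂ _ g * rowSum (rowFn n D) =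
      MonoidAlgebra.of ℂ _ w * rowSum (rowFn n D) := by
    intro g
    obtain ⟨v, hv, hmax⟩ := Finset.exists_max_image (fiberPerms (rowFn n D))
      (fun v => permMoment (g * v)) ⟨1, one_mem_fiberPerms _⟩
    refine ⟨g * v, ?_, by rw [map_mul, mul_assoc, of_mul_rowSum hv]⟩
    rw [Finset.mem_filter]
    refine ⟨Finset.mem_univ _, fun j hj => ?_⟩
    by_contra hjD
    have hjn : j + 1 < n := by
      have := Finset.mem_range.1 (descents_subset _ hj); omega
    have hsw : swap (⟨j, by omega⟩ : Fin n) ⟨j + 1, hjn⟩ ∈ fiberPerms (rowFn n D) :=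
      swap_mem_fiberPerms (by rw [rowFn_succ, if_neg hjD, add_zero])
    have h1 := permMoment_lt_mul_swap hjn hj
    have h2 := hmax _ (fiberPerms_mul hv hsw)
    rw [← mul_assoc] at h2
    exact absurd h1 (not_lt.2 h2)
  have hle : borderTabloid n D ≤ Submodule.span ℂ
      ((s.image fun w => MonoidAlgebra.of ℂ _ w * rowSum (rowFn n D) : Finset (SymAlg n)) :
        Set (SymAlg n)) := by
    intro x hx
    obtain ⟨a, rfl⟩ := mem_borderTabloid.1 hx
    induction a using MonoidAlgebra.induction_on with
    | of g =>
      obtain ⟨w, hw, h⟩ := hgen g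
      rw [h]
      exact Submodule.subset_span (Finset.mem_coe.2 (Finset.mem_image_of_mem _ hw))
    | add a b ha hb =>
      rw [add_mul]
      exact Submodule.add_mem _ (ha (mem_borderTabloid.2 ⟨_, rfl⟩))
        (hb (mem_borderTabloid.2 ⟨_, rfl⟩))
    | smul r a ha =>
      rw [smul_mul_assoc]
      exact Submodule.smul_mem _ _ (ha (mem_borderTabloid.2 ⟨_, rfl⟩))
  calc Module.finrank ℂ (borderTabloid n D) ≤ _ := Submodule.finrank_mono hle
    _ ≤ _ := finrank_span_finset_le_card _
    _ ≤ _ := Finset.card_image_le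

/-- Dimension count: the polytabloids of the permutations with descents in `D` are independent in
the right side, and their number bounds the dimension of the left. -/
lemma borderTabloid_eq_iSup {D : Finset ℕ} (hD : D ⊆ Finset.range (n - 1)) :
    borderTabloid n D = ⨆ E ∈ D.powerset, borderSpecht n E := by
  classical
  symm
  apply Submodule.eq_of_le_of_finrank_le
  · exact iSup₂_le fun E hE => borderSpecht_le_borderTabloid (Finset.mem_powerset.1 hE)
  refine (finrank_borderTabloid_le D).trans ?_
  set s := Finset.univ.filter fun w : Perm (Fin n) => descents w ⊆ D with hs
  have hli := linearIndepOn_descentPolytabloid (n := n) hD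
  rw [← hs] at hli
  have h1 := finrank_span_eq_card (R := ℂ) (b := fun w : (s : Set (Perm (Fin n))) =>
    descentPolytabloid (w : Perm (Fin n))) hli
  have h2 : Fintype.card (s : Set (Perm (Fin n))) = s.card := by simp
  rw [h2] at h1
  rw [← h1]
  apply Submodule.finrank_mono
  rw [Submodule.span_le]
  rintro _ ⟨⟨w, hw⟩, rfl⟩
  have hwD : descents w ⊆ D := (Finset.mem_filter.1 hw).2
  exact Submodule.mem_iSup_of_mem (descents w)
    (Submodule.mem_iSup_of_mem (Finset.mem_powerset.2 hwD) (descentPolytabloid_mem w))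

lemma iSupIndep_borderSpecht {D : Finset ℕ} (hD : D ⊆ Finset.range (n - 1)) :
    iSupIndep fun E : D.powerset => borderSpecht n (E : Finset ℕ) := by
  classical
  rw [iSupIndep_iff_finsetSum_eq_zero_imp_eq_zero]
  intro s v hv h0 E hE
  let v' : Finset ℕ → SymAlg n := fun F => if h : F ∈ D.powerset then v ⟨F, h⟩ else 0
  have hv' : ∀ F : D.powerset, v' F = v F := fun F => by simp only [v']; rw [dif_pos F.2]
  have h1 := eq_zero_of_sum_borderSpecht (n := n) (s := s.map (Function.Embedding.subtype _))
    (v := v') ?_ ?_ ?_ (E : Finset ℕ) (Finset.mem_map_of_mem _ hE)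
  · rw [← hv' E]; exact h1
  · intro F hF
    obtain ⟨F', -, rfl⟩ := Finset.mem_map.1 hF
    exact (Finset.mem_powerset.1 F'.2).trans hD
  · intro F hF
    obtain ⟨F', hF', rfl⟩ := Finset.mem_map.1 hF
    have := hv F' hF'
    rw [← hv' F'] at this
    exact this
  · rw [Finset.sum_map, ← h0]
    exact Finset.sum_congr rfl fun F _ => hv' F

end Decomposition

end FoulkesCarries
end

noncomputable section
namespace FoulkesCarries

open Equiv Equiv.Perm

/-! ### Traces -/

section Traces

variable {n : ℕ}

/-- Left multiplication by a permutation on the group algebra. -/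
def leftMul (π : Perm (Fin n)) : Module.End ℂ (SymAlg n) :=
  LinearMap.mulLeft ℂ (MonoidAlgebra.of ℂ _ π)

lemma leftMul_apply (π : Perm (Fin n)) (x : SymAlg n) :
    leftMul π x = MonoidAlgebra.of ℂ _ π * x := rfl

lemma leftMul_mapsTo_borderSpecht (π : Perm (Fin n)) (D : Finset ℕ) :
    Set.MapsTo (leftMul π) (borderSpecht n D) (borderSpecht n D) := by
  intro x hx
  obtain ⟨a, rfl⟩ := mem_borderSpecht.1 hx
  exact mem_borderSpecht.2 ⟨MonoidAlgebra.of ℂ _ π * a, by rw [leftMul_apply, mul_assoc]⟩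

lemma leftMul_mapsTo_borderTabloid (π : Perm (Fin n)) (D : Finset ℕ) :
    Set.MapsTo (leftMul π) (borderTabloid n D) (borderTabloid n D) := by
  intro x hx
  obtain ⟨a, rfl⟩ := mem_borderTabloid.1 hx
  exact mem_borderTabloid.2 ⟨MonoidAlgebra.of ℂ _ π * a, by rw [leftMul_apply, mul_assoc]⟩

lemma spechtCharacter_eq_trace (D : Finset ℕ) (π : Perm (Fin n)) :
    spechtCharacter (rowFn n D) (colFn n D) π =
      LinearMap.trace ℂ (borderSpecht n D)
        ((leftMul π).restrict (leftMul_mapsTo_borderSpecht π D)) := rfl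

lemma trace_restrict_eq_of_projection {V : Type*} [AddCommGroup V] [Module ℂ V]
    [Module.Finite ℂ V] {N : Submodule ℂ V} {f P : Module.End ℂ V} (hf : Set.MapsTo f N N)
    (hP : ∀ v, P v ∈ N) (hid : ∀ v ∈ N, P v = v) :
    LinearMap.trace ℂ N (f.restrict hf) = LinearMap.trace ℂ V (f ∘ₗ P) := by
  let p : V →ₗ[ℂ] N := P.codRestrict N hP
  have h1 : f ∘ₗ P = (N.subtype ∘ₗ f.restrict hf) ∘ₗ p := by
    ext v; rfl
  have h2 : p ∘ₗ (N.subtype ∘ₗ f.restrict hf) = f.restrict hf := by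
    ext v
    exact hid _ (hf v.2)
  rw [h1, LinearMap.trace_comp_comm', h2]

lemma trace_eq_sum_coeff (f : Module.End ℂ (SymAlg n)) :
    LinearMap.trace ℂ (SymAlg n) f =
      ∑ g : Perm (Fin n), (f (MonoidAlgebra.single g 1)).coeff g := by
  classical
  rw [LinearMap.trace_eq_matrix_trace ℂ (MonoidAlgebra.basis (Perm (Fin n)) ℂ), Matrix.trace]
  refine Finset.sum_congr rfl fun g _ => ?_
  rw [Matrix.diag_apply, LinearMap.toMatrix_apply, MonoidAlgebra.basis_apply]
  rfl

/-- The normalized right multiplication by `rowSum` projects onto the tabloid module, so the trace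
can be taken on the whole group algebra in the basis of permutations. -/
lemma trace_borderTabloid (D : Finset ℕ) (π : Perm (Fin n)) :
    LinearMap.trace ℂ (borderTabloid n D)
      ((leftMul π).restrict (leftMul_mapsTo_borderTabloid π D)) =
    ((fiberPerms (rowFn n D)).card : ℂ)⁻¹ *
      ((Finset.univ.filter fun g : Perm (Fin n) => g⁻¹ * π * g ∈ fiberPerms (rowFn n D)).card : ℂ)
    := by
  classical
  have hc := card_fiberPerms_ne_zero (rowFn n D)
  rw [trace_restrict_eq_of_projection (P := ((fiberPerms (rowFn n D)).card : ℂ)⁻¹ •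
    LinearMap.mulRight ℂ (rowSum (rowFn n D))) (leftMul_mapsTo_borderTabloid π D),
    trace_eq_sum_coeff, ← Finset.sum_boole, Finset.mul_sum]
  · refine Finset.sum_congr rfl fun g _ => ?_
    rw [LinearMap.comp_apply, LinearMap.smul_apply, map_smul, MonoidAlgebra.coeff_smul_apply,
      smul_eq_mul, LinearMap.mulRight_apply, leftMul_apply, ← mul_assoc, MonoidAlgebra.of_apply,
      MonoidAlgebra.single_mul_single, coeff_mul_rowSum]
    congr 1
    simp only [MonoidAlgebra.coeff_single, Finsupp.single_apply, mul_one]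
    have h1 : ∀ p : Perm (Fin n), π * g = g * p⁻¹ ↔ (g⁻¹ * π * g)⁻¹ = p := by
      intro p
      rw [inv_eq_iff_eq_inv, mul_assoc, inv_mul_eq_iff_eq_mul]
    simp only [h1]
    rw [Finset.sum_ite_eq]
    have h2 : (g⁻¹ * π * g)⁻¹ ∈ fiberPerms (rowFn n D) ↔
        g⁻¹ * π * g ∈ fiberPerms (rowFn n D) :=
      ⟨fun h => by simpa using fiberPerms_inv h, fiberPerms_inv⟩
    simp only [h2]
  · intro v
    refine Submodule.smul_mem _ _ (mem_borderTabloid.2 ⟨v, rfl⟩)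
  · intro v hv
    obtain ⟨a, rfl⟩ := mem_borderTabloid.1 hv
    rw [LinearMap.smul_apply, LinearMap.mulRight_apply, mul_assoc,
      rowSum_mul_rowSum (Finset.Subset.refl _), mul_smul_comm, smul_smul, inv_mul_cancel₀ hc,
      one_smul]

lemma sum_spechtCharacter {D : Finset ℕ} (hD : D ⊆ Finset.range (n - 1)) (π : Perm (Fin n)) :
    ∑ E ∈ D.powerset, spechtCharacter (rowFn n E) (colFn n E) π =
    ((fiberPerms (rowFn n D)).card : ℂ)⁻¹ *
      ((Finset.univ.filter fun g : Perm (Fin n) => g⁻¹ * π * g ∈ fiberPerms (rowFn n D)).card : ℂ)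
    := by
  rw [← trace_borderTabloid]
  simp only [spechtCharacter_eq_trace]
  exact (LinearMap.trace_eq_sum_trace_restrict_of_eq_biSup D.powerset (iSupIndep_borderSpecht hD)
    (leftMul_mapsTo_borderSpecht π) (borderTabloid n D) (borderTabloid_eq_iSup hD)
    (leftMul_mapsTo_borderTabloid π D)).symm

end Traces

end FoulkesCarries
end

noncomputable section
namespace FoulkesCarries

open Equiv Equiv.Perm

/-! ### Words and Foulkes characters -/

section Words

variable {n : ℕ}

/-- The fibres of a word are permuted by its stabilizer. -/
def wordPerms {x : ℕ} (s : Fin n → Fin x) : Finset (Perm (Fin n)) :=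
  fiberPerms fun m => ((s m : ℕ) : ℤ)

lemma mem_wordPerms {x : ℕ} {s : Fin n → Fin x} {p : Perm (Fin n)} :
    p ∈ wordPerms s ↔ ∀ m, s (p m) = s m := by
  simp [wordPerms, mem_fiberPerms, Fin.ext_iff]

/-- A sum over all words, sorted by their increasing rearrangement. -/
lemma sum_words {x : ℕ} (F : (Fin n → Fin x) → ℂ) :
    ∑ h, F h = ∑ s with Monotone s, ((wordPerms s).card : ℂ)⁻¹ *
      ∑ g : Perm (Fin n), F (s ∘ (g⁻¹ : Perm (Fin n))) := by
  classical
  have h1 : ∀ s : Fin n → Fin x, ∑ g : Perm (Fin n), F (s ∘ (g⁻¹ : Perm (Fin n))) =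
      ∑ h, F h * ((Finset.univ.filter fun g : Perm (Fin n) =>
        s ∘ (g⁻¹ : Perm (Fin n)) = h).card : ℂ) := by
    intro s
    simp_rw [← Finset.sum_boole, Finset.mul_sum]
    rw [Finset.sum_comm]
    refine Finset.sum_congr rfl fun g _ => ?_
    simp
  simp_rw [h1, Finset.mul_sum]
  rw [Finset.sum_comm]
  refine Finset.sum_congr rfl fun h _ => ?_
  -- Only the sorted form of `h` contributes, and the number of permutations carrying it to `h` is
  -- the order of its stabilizer.
  set σ := Tuple.sort h with hσ
  have hmono : Monotone (h ∘ σ) := Tuple.monotone_sort h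
  rw [Finset.sum_eq_single_of_mem (h ∘ σ) (Finset.mem_filter.2 ⟨Finset.mem_univ _, hmono⟩)]
  · have hcard : (Finset.univ.filter fun g : Perm (Fin n) =>
        (h ∘ σ) ∘ (g⁻¹ : Perm (Fin n)) = h).card = (wordPerms (h ∘ σ)).card := by
      symm
      refine Finset.card_bij' (fun p _ => σ * p⁻¹) (fun g _ => g⁻¹ * σ) ?_ ?_ ?_ ?_
      · intro p hp
        rw [mem_wordPerms] at hp
        rw [Finset.mem_filter]
        refine ⟨Finset.mem_univ _, funext fun m => ?_⟩
        have := hp (σ⁻¹ m)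
        simp only [Function.comp_apply] at this ⊢
        rw [mul_inv_rev, inv_inv, Perm.mul_apply, this]
        simp
      · intro g hg
        rw [Finset.mem_filter] at hg
        rw [mem_wordPerms]
        intro m
        exact congrFun hg.2 (σ m)
      · intro p _; simp
      · intro g _; simp
    have hne : ((wordPerms (h ∘ σ)).card : ℂ) ≠ 0 := card_fiberPerms_ne_zero _
    rw [hcard, mul_comm, mul_assoc, mul_inv_cancel₀ hne, mul_one]
  · intro s hs hne
    rw [Finset.filter_false_of_mem, Finset.card_empty, Nat.cast_zero, mul_zero, mul_zero]
    intro g _ hg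
    apply hne
    have hsg : s = h ∘ g := by
      rw [← hg]; ext m; simp
    rw [hsg]
    exact Tuple.unique_monotone (hsg ▸ (Finset.mem_filter.1 hs).2) hmono

/-- The positions where a word increases. -/
def ascents {x : ℕ} (s : Fin n → Fin x) : Finset ℕ :=
  (Finset.range (n - 1)).filter fun j => ∃ h : j + 1 < n, s ⟨j, by omega⟩ < s ⟨j + 1, h⟩

lemma mem_ascents {x : ℕ} {s : Fin n → Fin x} {j : ℕ} (h : j + 1 < n) :
    j ∈ ascents s ↔ s ⟨j, by omega⟩ < s ⟨j + 1, h⟩ := by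
  rw [ascents, Finset.mem_filter, Finset.mem_range]
  exact ⟨fun ⟨_, _, h2⟩ => h2, fun h2 => ⟨by omega, h, h2⟩⟩

lemma wordPerms_eq {x : ℕ} {s : Fin n → Fin x} (hs : Monotone s) :
    wordPerms s = fiberPerms (rowFn n (ascents s)) := by
  have key : ∀ a b : Fin n, a ≤ b → (s a = s b ↔
      rowFn n (ascents s) a = rowFn n (ascents s) b) := by
    intro a b hab
    rw [rowFn_eq_iff _ hab]
    constructor
    · intro h j hj haj
      by_contra hbj
      have hjn : j + 1 < n := by have := b.isLt; omega
      have h1 := (mem_ascents hjn).1 hj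
      have h2 : s a ≤ s ⟨j, by omega⟩ := hs haj
      have h3 : s ⟨j + 1, hjn⟩ ≤ s b := hs (by rw [Fin.le_def]; simp only; omega)
      exact absurd (h1.trans_le h3) (not_lt.2 (h ▸ h2))
    · intro h
      obtain ⟨b, hb⟩ := b
      have hab' : (a : ℕ) ≤ b := hab
      clear hab
      induction b, hab' using Nat.le_induction with
      | base => rfl
      | succ b hab ih =>
        rw [ih (by omega) fun j hj haj => by have := h j hj haj; simp only at this ⊢; omega]
        have hnot : b ∉ ascents s := fun hb' => by
          have := h b hb' hab; simp only at this; omega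
        rw [mem_ascents hb, not_lt] at hnot
        exact le_antisymm (hs (by rw [Fin.le_def]; simp only; omega)) hnot
  ext p
  rw [mem_wordPerms, mem_fiberPerms]
  refine forall_congr' fun m => ?_
  rcases le_total (p m) m with h | h
  · exact key _ _ h
  · rw [eq_comm, key _ _ h, eq_comm]

lemma add_le_of_strictMono {t : Fin n → ℕ} (ht : StrictMono t) {a b : Fin n} (hab : a ≤ b) :
    t a + b ≤ t b + a := by
  obtain ⟨b, hb⟩ := b
  have hab' : (a : ℕ) ≤ b := hab
  clear hab
  induction b, hab' using Nat.le_induction with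
  | base => exact le_rfl
  | succ b hab ih =>
    have h1 := ih (by omega)
    have h2 : t ⟨b, by omega⟩ < t ⟨b + 1, hb⟩ := ht (by rw [Fin.lt_def]; simp)
    simp only at h1 ⊢
    omega

lemma card_strictMono (N : ℕ) :
    (Finset.univ.filter fun t : Fin n → Fin N => StrictMono t).card = N.choose n := by
  classical
  have h1 : (Finset.univ.filter fun t : Fin n → Fin N => StrictMono t).card =
      Fintype.card (Fin n ↪o Fin N) := by
    rw [← Fintype.card_subtype]
    refine Fintype.card_congr ⟨fun t => OrderEmbedding.ofStrictMono t.1 t.2,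
      fun e => ⟨e, e.strictMono⟩, fun t => rfl, fun e => by ext; rfl⟩
  rw [h1, ← Nat.card_eq_fintype_card, Nat.card_congr Set.powersetCard.ofFinEmbEquiv,
    Set.powersetCard.card, Nat.card_eq_fintype_card, Fintype.card_fin]

lemma rowFn_le (E : Finset ℕ) (m : Fin n) : (E.filter fun j => j < (m : ℕ)).card ≤ m := by
  calc _ ≤ (Finset.range m).card := Finset.card_le_card fun j hj =>
        Finset.mem_range.2 (Finset.mem_filter.1 hj).2
    _ = m := Finset.card_range _

/-- Adding `m` to the letter at position `m` makes a weakly increasing word strict. Subtracting the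
number `r m` of elements of `E` below `m` cancels the gain at the ascents already forced. The
results are the strictly increasing words in `x + n - 1 - E.card` letters. -/
lemma card_monotone_ascents (hn : 0 < n) {E : Finset ℕ} (hE : E ⊆ Finset.range (n - 1)) (x : ℕ) :
    (Finset.univ.filter fun s : Fin n → Fin x => Monotone s ∧ E ⊆ ascents s).card =
      (x + n - 1 - E.card).choose n := by
  classical
  have hEc : E.card ≤ n - 1 := by simpa using Finset.card_le_card hE
  let r : Fin n → ℕ := fun m => (E.filter fun j => j < (m : ℕ)).card
  have hr : ∀ m, r m ≤ m := rowFn_le E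
  have hrE : ∀ m, r m ≤ E.card := fun m => Finset.card_filter_le _ _
  have hrest : ∀ m : Fin n, E.card ≤ r m + (n - 1 - m) := by
    intro m
    have h1 := Finset.card_filter_add_card_filter_not (s := E) (fun j => j < (m : ℕ))
    have h2 : (E.filter fun j => ¬ j < (m : ℕ)).card ≤ n - 1 - m := by
      calc _ ≤ (Finset.Ico (m : ℕ) (n - 1)).card := Finset.card_le_card fun j hj => by
            rw [Finset.mem_filter] at hj
            have := Finset.mem_range.1 (hE hj.1)
            rw [Finset.mem_Ico]; omega
        _ = _ := Nat.card_Ico _ _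
    simp only [r]
    omega
  have hstep : ∀ (j : ℕ) (hj : j + 1 < n), r ⟨j + 1, hj⟩ = r ⟨j, by omega⟩ +
      if j ∈ E then 1 else 0 := by
    intro j hj
    have := rowFn_succ E hj
    simp only [rowFn] at this
    simp only [r]
    split_ifs at this ⊢ <;> omega
  have hiff : ∀ S : Fin n → ℕ, (StrictMono fun m => (S m : ℤ) + (m : ℕ) - r m) ↔
      ∀ (j : ℕ) (hj : j + 1 < n), S ⟨j, by omega⟩ + (if j ∈ E then 1 else 0) ≤ S ⟨j + 1, hj⟩ := by
    intro S
    constructor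
    · intro h j hj
      have h1 : (S ⟨j, by omega⟩ : ℤ) + (j : ℕ) - r ⟨j, by omega⟩ <
          S ⟨j + 1, hj⟩ + ((j + 1 : ℕ) : ℤ) - r ⟨j + 1, hj⟩ :=
        @h ⟨j, by omega⟩ ⟨j + 1, hj⟩ (by rw [Fin.lt_def]; simp)
      rw [hstep j hj] at h1
      split_ifs at h1 ⊢ <;> omega
    · intro h
      refine strictMono_of_succ fun j hj => ?_
      have h1 := h j hj
      rw [hstep j hj]
      simp only
      split_ifs at h1 ⊢ <;> omega
  have hmono : ∀ s : Fin n → Fin x, (Monotone s ∧ E ⊆ ascents s) ↔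
      ∀ (j : ℕ) (hj : j + 1 < n),
        (s ⟨j, by omega⟩ : ℕ) + (if j ∈ E then 1 else 0) ≤ s ⟨j + 1, hj⟩ := by
    intro s
    constructor
    · rintro ⟨h1, h2⟩ j hj
      split_ifs with hjE
      · exact (mem_ascents hj).1 (h2 hjE)
      · exact h1 (by rw [Fin.le_def]; simp)
    · intro h
      constructor
      · have : ∀ (j : ℕ) (hj : j + 1 < n), s ⟨j, by omega⟩ ≤ s ⟨j + 1, hj⟩ := fun j hj =>
          Fin.le_def.2 ((Nat.le_add_right _ _).trans (h j hj))
        obtain ⟨k, rfl⟩ : ∃ k, n = k + 1 := ⟨n - 1, by omega⟩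
        rw [Fin.monotone_iff_le_succ]
        exact fun i => this i (by omega)
      · intro j hj
        have hjn : j + 1 < n := by have := Finset.mem_range.1 (hE hj); omega
        have := h j hjn
        rw [if_pos hj] at this
        exact (mem_ascents hjn).2 this
  set N := x + n - 1 - E.card with hN
  rw [← card_strictMono (n := n) N]
  have hbound : ∀ (s : Fin n → Fin x) (m : Fin n), (s m : ℕ) + m - r m < N := by
    intro s m
    have h1 := (s m).isLt
    have h2 := hrest m
    have h3 := hr m
    have h4 := m.isLt
    omega
  have hlow : ∀ t : Fin n → Fin N, StrictMono t → ∀ m : Fin n,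
      (m : ℕ) ≤ t m + r m ∧ (t m : ℕ) + r m - m < x := by
    intro t ht m
    have ht' : StrictMono fun m => (t m : ℕ) := fun a b h => ht h
    have h1 := add_le_of_strictMono ht' (a := ⟨0, hn⟩) (b := m) (by rw [Fin.le_def]; simp)
    have h2 := add_le_of_strictMono ht' (a := m) (b := ⟨n - 1, by omega⟩)
      (by rw [Fin.le_def]; simp only; omega)
    have h3 := (t ⟨n - 1, by omega⟩).isLt
    have h4 := hrE m
    have h5 := m.isLt
    simp only at h1 h2
    omega
  refine Finset.card_bij' (fun s _ m => ⟨(s m : ℕ) + m - r m, hbound s m⟩)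
    (fun t ht m => ⟨(t m : ℕ) + r m - m, (hlow t (Finset.mem_filter.1 ht).2 m).2⟩) ?_ ?_ ?_ ?_
  · intro s hs
    rw [Finset.mem_filter, hmono] at hs
    have h1 := (hiff fun m => (s m : ℕ)).2 hs.2
    rw [Finset.mem_filter]
    refine ⟨Finset.mem_univ _, fun a b hab => ?_⟩
    have h2 := h1 hab
    have h3 := hr a
    have h4 := hr b
    rw [Fin.lt_def]
    simp only at h2 ⊢
    omega
  · intro t ht
    have ht2 := (Finset.mem_filter.1 ht).2
    rw [Finset.mem_filter, hmono]
    refine ⟨Finset.mem_univ _, ?_⟩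
    rw [← hiff fun m => (t m : ℕ) + r m - m]
    intro a b hab
    have h1 : (t a : ℕ) < t b := ht2 hab
    have h2 := (hlow t ht2 a).1
    have h3 := (hlow t ht2 b).1
    simp only
    omega
  · intro s _
    ext m
    have := hr m
    simp only
    omega
  · intro t ht
    have ht2 := (Finset.mem_filter.1 ht).2
    ext m
    have := (hlow t ht2 m).1
    simp only
    omega

/-- Each sorted word `s` contributes the tabloid character of `ascents s`, hence the Specht
characters of all `E ⊆ ascents s`. Exchanging the sums leaves the number of `s` for each `E`. -/
lemma pow_numCycles_eq_sum (hn : 0 < n) (x : ℕ) (π : Perm (Fin n)) :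
    (x : ℂ) ^ numCycles π = ∑ E ∈ (Finset.range (n - 1)).powerset,
      spechtCharacter (rowFn n E) (colFn n E) π * ((x + n - 1 - E.card).choose n : ℂ) := by
  classical
  rw [← Nat.cast_pow, ← card_invariant_colorings x π, ← Finset.sum_boole, sum_words]
  have h1 : ∀ s ∈ Finset.univ.filter (fun s : Fin n → Fin x => Monotone s),
      (((wordPerms s).card : ℂ)⁻¹ * ∑ g : Perm (Fin n),
        if ∀ a, (s ∘ (g⁻¹ : Perm (Fin n))) (π a) = (s ∘ (g⁻¹ : Perm (Fin n))) a
          then (1 : ℂ) else 0) =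
      ∑ E ∈ (ascents s).powerset, spechtCharacter (rowFn n E) (colFn n E) π := by
    intro s hs
    rw [sum_spechtCharacter (D := ascents s) (Finset.filter_subset _ _),
      ← wordPerms_eq (Finset.mem_filter.1 hs).2, Finset.sum_boole]
    congr 4
    ext g
    simp only [mem_wordPerms, Function.comp_apply, Perm.mul_apply]
    constructor
    · intro h m
      rw [h (g m)]
      simp
    · intro h a
      have := h (g⁻¹ a)
      simpa using this
  rw [Finset.sum_congr rfl h1]
  have h2 : ∀ E ∈ (Finset.range (n - 1)).powerset,
      spechtCharacter (rowFn n E) (colFn n E) π * ((x + n - 1 - E.card).choose n : ℂ) =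
      ∑ s ∈ Finset.univ.filter (fun s : Fin n → Fin x => Monotone s),
        if E ⊆ ascents s then spechtCharacter (rowFn n E) (colFn n E) π else 0 := by
    intro E hE
    rw [← card_monotone_ascents hn (Finset.mem_powerset.1 hE) x, ← Finset.sum_filter,
      Finset.filter_filter, Finset.sum_const, nsmul_eq_mul, mul_comm]
  rw [Finset.sum_congr rfl h2, Finset.sum_comm]
  refine Finset.sum_congr rfl fun s _ => ?_
  rw [← Finset.sum_filter]
  refine Finset.sum_congr ?_ fun _ _ => rfl
  ext E
  simp only [Finset.mem_powerset, Finset.mem_filter]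
  exact ⟨fun h => ⟨h.trans (Finset.filter_subset _ _), h⟩, fun h => h.2⟩

end Words

end FoulkesCarries
end

noncomputable section
namespace FoulkesCarries

open Equiv Equiv.Perm

/-! ### The values of the Foulkes characters -/

section Foulkes

variable {n : ℕ}

/-- The boxes after which the border shape of a composition goes up. -/
def upSteps (c : Composition n) : Finset ℕ :=
  (Finset.range (c.length - 1)).image fun k => c.sizeUpTo (k + 1) - 1

lemma sizeUpTo_lt_of_lt (c : Composition n) {k l : ℕ} (hkl : k < l) (hl : l ≤ c.length) :
    c.sizeUpTo k < c.sizeUpTo l :=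
  (c.sizeUpTo_strict_mono (hkl.trans_le hl)).trans_le (c.monotone_sizeUpTo hkl)

lemma sizeUpTo_sub_one_injOn (c : Composition n) :
    Set.InjOn (fun k => c.sizeUpTo (k + 1) - 1) (Finset.range (c.length - 1)) := by
  have key : ∀ k l : ℕ, k < l → l < c.length - 1 →
      c.sizeUpTo (k + 1) - 1 ≠ c.sizeUpTo (l + 1) - 1 := by
    intro k l hkl hl
    have h1 := sizeUpTo_lt_of_lt c (Nat.succ_lt_succ hkl) (by omega)
    have h2 := sizeUpTo_lt_of_lt c (show 0 < k + 1 by omega) (by omega)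
    simp only [Nat.succ_eq_add_one] at h1 h2
    omega
  intro k hk l hl h
  rw [Finset.mem_coe, Finset.mem_range] at hk hl
  rcases lt_trichotomy k l with h1 | h1 | h1
  · exact absurd h (key k l h1 hl)
  · exact h1
  · exact absurd h.symm (key l k h1 hk)

lemma card_upSteps (c : Composition n) : (upSteps c).card = c.length - 1 := by
  rw [upSteps, Finset.card_image_of_injOn (sizeUpTo_sub_one_injOn c), Finset.card_range]

/-- The last box of block `k` is `sizeUpTo (k + 1) - 1`, so the up steps before `m` are the ends of
the blocks preceding that of `m`. -/
lemma rowFn_upSteps (c : Composition n) : rowFn n (upSteps c) = borderRow c := by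
  funext m
  rw [rowFn, borderRow, Nat.cast_inj]
  have h0 := (c.index m).isLt
  have h : (upSteps c).filter (fun j => j < (m : ℕ)) =
      (Finset.range (c.index m)).image fun k => c.sizeUpTo (k + 1) - 1 := by
    rw [upSteps, Finset.filter_image]
    congr 1
    ext k
    rw [Finset.mem_filter, Finset.mem_range, Finset.mem_range]
    constructor
    · rintro ⟨h1, h2⟩
      by_contra h3
      have h4 := c.monotone_sizeUpTo (show (c.index m : ℕ).succ ≤ k + 1 by omega)
      have h5 := c.lt_sizeUpTo_index_succ m
      rw [Fin.val_succ] at h5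
      simp only [Nat.succ_eq_add_one] at h4
      omega
    · intro h1
      have h2 := c.monotone_sizeUpTo (show k + 1 ≤ (c.index m : ℕ) by omega)
      have h3 := c.sizeUpTo_index_le m
      have h4 := sizeUpTo_lt_of_lt c (show 0 < k + 1 by omega) (by omega)
      exact ⟨by omega, by omega⟩
  rw [h, Finset.card_image_of_injOn, Finset.card_range]
  refine (sizeUpTo_sub_one_injOn c).mono fun k hk => ?_
  rw [Finset.mem_coe, Finset.mem_range] at *
  omega

lemma colFn_upSteps (c : Composition n) : colFn n (upSteps c) = borderCol c := by
  funext m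
  rw [colFn, rowFn_upSteps, borderCol]

/-- Identifies `upSteps` with the standard encoding of compositions by subsets of `Fin (n - 1)`,
which makes it a bijection onto the subsets of `Finset.range (n - 1)`. -/
lemma upSteps_eq_map (c : Composition n) : upSteps c =
    (compositionAsSetEquiv n (compositionEquiv n c)).map Fin.valEmbedding := by
  have hmem : ∀ i : Fin (n - 1), i ∈ compositionAsSetEquiv n (compositionEquiv n c) ↔
      (⟨1 + (i : ℕ), by omega⟩ : Fin (n + 1)) ∈ c.boundaries := by
    intro i
    exact Set.mem_toFinset
  ext j
  simp only [Finset.mem_map, hmem, Composition.boundaries, Finset.mem_univ, true_and, upSteps,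
    Finset.mem_image, Finset.mem_range]
  constructor
  · rintro ⟨k, hk, rfl⟩
    have h1 := sizeUpTo_lt_of_lt c (show 0 < k + 1 by omega) (by omega)
    have h2 := sizeUpTo_lt_of_lt c (show k + 1 < c.length by omega) le_rfl
    rw [c.sizeUpTo_length] at h2
    refine ⟨⟨c.sizeUpTo (k + 1) - 1, by omega⟩, ⟨⟨k + 1, by omega⟩, ?_⟩, rfl⟩
    rw [Fin.ext_iff]
    change c.sizeUpTo (k + 1) = 1 + (c.sizeUpTo (k + 1) - 1)
    omega
  · rintro ⟨i, ⟨k, hk⟩, rfl⟩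
    have h1 : c.sizeUpTo k = 1 + (i : ℕ) := congrArg Fin.val hk
    have h2 : (k : ℕ) ≠ 0 := by
      intro h
      rw [h, c.sizeUpTo_zero] at h1
      omega
    have h3 : (k : ℕ) ≠ c.length := by
      intro h
      rw [h, c.sizeUpTo_length] at h1
      omega
    refine ⟨k - 1, by omega, ?_⟩
    rw [Nat.sub_add_cancel (by omega), h1]
    simp

lemma foulkes_eq_sum (hn : 0 < n) (i : ℕ) (π : Perm (Fin n)) :
    foulkes n i π = ∑ E ∈ (Finset.range (n - 1)).powersetCard i,
      spechtCharacter (rowFn n E) (colFn n E) π := by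
  classical
  refine Finset.sum_bij (fun c _ => upSteps c) ?_ ?_ ?_ ?_
  · intro c hc
    rw [Finset.mem_powersetCard, card_upSteps, (Finset.mem_filter.1 hc).2, upSteps_eq_map]
    refine ⟨fun j hj => ?_, rfl⟩
    obtain ⟨k, -, rfl⟩ := Finset.mem_map.1 hj
    exact Finset.mem_range.2 k.isLt
  · intro c _ d _ h
    rw [upSteps_eq_map, upSteps_eq_map] at h
    exact (compositionEquiv n).injective
      ((compositionAsSetEquiv n).injective (Finset.map_injective _ h))
  · intro E hE
    rw [Finset.mem_powersetCard] at hE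
    set c := (compositionEquiv n).symm ((compositionAsSetEquiv n).symm
      (Finset.univ.filter fun k : Fin (n - 1) => (k : ℕ) ∈ E)) with hc
    have h : upSteps c = E := by
      rw [upSteps_eq_map, hc, Equiv.apply_symm_apply, Equiv.apply_symm_apply]
      ext j
      simp only [Finset.mem_map, Finset.mem_filter, Finset.mem_univ, true_and]
      constructor
      · rintro ⟨k, hk, rfl⟩
        exact hk
      · exact fun hj => ⟨⟨j, Finset.mem_range.1 (hE.1 hj)⟩, hj, rfl⟩
    refine ⟨c, Finset.mem_filter.2 ⟨Finset.mem_univ _, ?_⟩, h⟩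
    have h1 := card_upSteps c
    have h2 := c.length_pos_of_pos hn
    rw [h, hE.2] at h1
    omega
  · intro c _
    rw [rowFn_upSteps, colFn_upSteps]

lemma pow_numCycles_eq_sum_foulkes (hn : 0 < n) (x : ℕ) (π : Perm (Fin n)) :
    (x : ℂ) ^ numCycles π =
      ∑ r ∈ Finset.range n, foulkes n r π * ((x + n - 1 - r).choose n : ℂ) := by
  rw [pow_numCycles_eq_sum hn, Finset.sum_powerset, Finset.card_range, Nat.sub_add_cancel hn]
  refine Finset.sum_congr rfl fun r _ => ?_
  rw [foulkes_eq_sum hn, Finset.sum_mul]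
  exact Finset.sum_congr rfl fun E hE => by rw [(Finset.mem_powersetCard.1 hE).2]

/-- Substitute the expansion of the powers in Foulkes characters and invert the binomial matrix. -/
lemma foulkes_eq_foulkesValue (i : Fin n) (π : Perm (Fin n)) :
    foulkes n i π = foulkesValue n i (numCycles π) := by
  have hn : 0 < n := Fin.pos i
  simp only [foulkesValue, pow_numCycles_eq_sum_foulkes hn, Finset.mul_sum]
  rw [Finset.sum_comm]
  have h : ∀ r ∈ Finset.range n, ∑ k ∈ Finset.range ((i : ℕ) + 1),
      (-1 : ℂ) ^ k * ((n + 1).choose k : ℂ) *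
        (foulkes n r π * ((i + 1 - k + n - 1 - r : ℕ).choose n : ℂ)) =
      if (i : ℕ) = r then foulkes n r π else 0 := by
    intro r hr
    rw [← mul_boole, ← sum_choose_mul_choose_eq_ite i.isLt (Finset.mem_range.1 hr),
      Finset.mul_sum]
    exact Finset.sum_congr rfl fun k _ => by ring
  rw [Finset.sum_congr rfl h, Finset.sum_ite_eq, if_pos (Finset.mem_range.2 i.isLt)]

end Foulkes

end FoulkesCarries
end

theorem mainTheorem11 (n b : ℕ) (hb : 2 ≤ b) :
    ∃ hφ : ∀ i : Fin n, FoulkesCarries.foulkes n i ∈ FoulkesCarries.CFlen n,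
      ∀ i j : Fin n,
        (FoulkesCarries.carriesMatrix n b i j : ℂ) =
          FoulkesCarries.bracket ⟨FoulkesCarries.foulkes n i, hφ i⟩
            (FoulkesCarries.twist b ⟨FoulkesCarries.foulkes n j, hφ j⟩) := by
  have hφ : ∀ i : Fin n, FoulkesCarries.foulkes n i ∈ FoulkesCarries.CFlen n :=
    fun i σ τ h => by
      rw [FoulkesCarries.foulkes_eq_foulkesValue, FoulkesCarries.foulkes_eq_foulkesValue, h]
  exact ⟨hφ, FoulkesCarries.carriesMatrix_eq_bracket hb FoulkesCarries.foulkes_eq_foulkesValue hφ⟩
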